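/- Let $p$ be a prime, let $\Bbbk$ be a perfect field of characteristic $p$, and let $f\in\Bbbk[[x_1,\dots,x_s]]$ and $g\in\Bbbk[[y_1,\dots,y_{s'}]]$ be elements of the respective maximal ideals (power series with zero constant term). Let $fg\in\Bbbk[[x_1,\dots,x_s,y_1,\dots,y_{s'}]]$ be their product. *Notation.* For $h$ in the maximal ideal $\mathfrak m_A$ of a power series ring $A=\Bbbk[[z_1,\dots,z_t]]$ put $R=A/(h)$, with maximal ideal $\mathfrak m$ and $d=\dim R$. The Hilbert–Kunz function of $h$ is $\mathrm{HK}_h(n)=\ell_R(R/\mathfrak m^{[p^n]})$, where $\mathfrak m^{[p^n]}$ is the ideal generated by the $p^n$-th powers of the elements of $\mathfrak m$. The F-signature function of $h$ is $\mathrm{FS}_h(n)$, the maximal rank of a free direct summand of the $R$-module $R^{1/p^n}$ (that is, of $F^n_*R$: the additive group $R$ on which $r\in R$ acts as multiplication by $r^{p^n}$). The Hilbert–Kunz series and the F-signature series are $\sum_{n\ge0}\mathrm{HK}_h(n)z^n$ and $\sum_{n\ge0}\mathrm{FS}_h(n)z^n$; a series is rational if it lies in $\mathbb Q(z)$. The Hilbert–Kunz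 multiplicity and the F-signature are $$e_{\mathrm{HK}}(h)=\lim_{n\to\infty}\mathrm{HK}_h(n)/p^{dn},\qquad \mathrm s(h)=\lim_{n\to\infty}\mathrm{FS}_h(n)/p^{dn}.$$ A sequence $(e_n)_{n\ge 0}$ of rational numbers is quasi-polynomial in $p^n$ if for some $m\ge0$ one has $e_n=a_m(n)p^{mn}+\dots+a_1(n)p^{n}+a_0(n)$ for all $n$, with periodic functions $a_i:\mathbb N\to\mathbb Q$ and $a_m$ not identically zero. Define $\phi_{h,p}(a/p^n)=p^{-tn}\dim_\Bbbk A/(z_1^{p^n},\dots,z_t^{p^n},h^a)$ for $a/p^n\in[0,1]$, $a,n\in\mathbb N$. Let $\mathscr V=\{1/p^m: m\in\mathbb N\}$. A function $\phi:\mathscr V\to\mathbb Q$ is a weak $p$-fractal if it lies in a finite-dimensional subspace of $\mathbb Q^{\mathscr V}$ that is stable under all the operators $T_{p^n|0}$, $n\in\mathbb N$, where $(T_{p^n|0}\phi)(1/p^m)=\phi(1/p^{m+n})$; $\phi_{h,p}$ is called a weak $p$-fractal if its restriction to $\mathscr V$ is one. **Theorem.** (i) If $\phi_{f,p}$ and $\phi_{g,p}$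 are weak $p$-fractals, then so is $\phi_{fg,p}$. (ii) If $f$ and $g$ have rational Hilbert–Kunz series, then so does $fg$; if $f$ and $g$ have rational F-signature series, then so does $fg$. (iii) If the Hilbert–Kunz functions of $f$ and $g$ are quasi-polynomial in $p^n$, then so is that of $fg$; if the F-signature functions of $f$ and $g$ are quasi-polynomial in $p^n$, then so is that of $fg$. If moreover $f\neq0$ and $g\neq0$, then: (iv) the limits defining $e_{\mathrm{HK}}(f)$, $e_{\mathrm{HK}}(g)$ and $e_{\mathrm{HK}}(fg)$ exist and $e_{\mathrm{HK}}(fg)=e_{\mathrm{HK}}(f)+e_{\mathrm{HK}}(g)$; (v) the limit defining $\mathrm s(fg)$ exists and $\mathrm s(fg)=0$. -/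

import Mathlib

open Filter Topology

noncomputable section

namespace HKProduct

/-! ### Sequences and generating series -/

/-- The ordinary generating series `∑ eₙ zⁿ ∈ ℚ⟦z⟧`. -/
def genSeries (e : ℕ → ℚ) : PowerSeries ℚ := PowerSeries.mk e

/-- A power series over `ℚ` is rational if it lies in `ℚ(z)`, that is, if it is a quotient `P / Q`
of polynomials with `Q ≠ 0`. -/
def IsRationalSeries (G : PowerSeries ℚ) : Prop :=
  ∃ P Q : Polynomial ℚ, Q ≠ 0 ∧ (Q : PowerSeries ℚ) * G = (P : PowerSeries ℚ)

/-- `e` is a quasi-polynomial in `pⁿ`: `eₙ = a_d(n) p^{dn} + ⋯ + a_0(n)` for some `d`, with periodic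
coefficients `a_i : ℕ → ℚ` and `a_d` not identically zero. -/
def IsQuasiPolynomial (p : ℕ) (e : ℕ → ℚ) : Prop :=
  ∃ (d : ℕ) (a : ℕ → ℕ → ℚ),
    (∀ i ≤ d, ∃ M : ℕ, 1 ≤ M ∧ Function.Periodic (a i) M) ∧
    (∃ n, a d n ≠ 0) ∧
    ∀ n, e n = ∑ i ∈ Finset.range (d + 1), a i n * (p : ℚ) ^ (i * n)

/-! ### The Hilbert-Kunz function -/

section Rings

variable {R : Type*} [CommRing R]

/-- The Krull dimension as a natural number (for rings of finite Krull dimension). -/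
def krullDimNat (R : Type*) [CommRing R] : ℕ := ((ringKrullDim R).unbotD 0).toNat

/-- The Frobenius power `I^{[q]}`, generated by all `q`-th powers of elements of `I`. -/
def frobeniusPower (I : Ideal R) (q : ℕ) : Ideal R :=
  Ideal.span ((fun x : R => x ^ q) '' (I : Set R))

/-- The Hilbert-Kunz function `n ↦ ℓ_R(R / I^{[pⁿ]})` of `R` with respect to `I`. -/
def hilbertKunz (p : ℕ) (I : Ideal R) (n : ℕ) : ℕ :=
  (Module.length R (R ⧸ frobeniusPower I (p ^ n))).toNat

/-- The normalised Hilbert-Kunz function `HK(n) / p^{n dim R}`. -/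
def hkRatio (p : ℕ) (I : Ideal R) (n : ℕ) : ℝ :=
  (hilbertKunz p I n : ℝ) / (p : ℝ) ^ (krullDimNat R * n)

/-- The Hilbert-Kunz multiplicity `lim HK(n) / p^{n dim R}`. -/
def hkMultiplicity (p : ℕ) (I : Ideal R) : ℝ := limUnder atTop (hkRatio p I)

/-! ### The F-signature function -/

/-- The maximal rank of a free direct summand of the `R`-module `M`. -/
def freeRank (R M : Type*) [CommRing R] [AddCommGroup M] [Module R M] : ℕ :=
  sSup {r : ℕ | ∃ (i : (Fin r → R) →ₗ[R] M) (π : M →ₗ[R] (Fin r → R)),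
    π ∘ₗ i = LinearMap.id}

/-- The `n`-th iterate `x ↦ x^{pⁿ}` of the Frobenius endomorphism of an algebra over a field of
characteristic `p`. -/
def frobeniusHom (k : Type*) [Field k] (p : ℕ) [Fact p.Prime] [CharP k p] (n : ℕ)
    (R : Type*) [CommRing R] [Algebra k R] : R →+* R where
  toFun x := x ^ p ^ n
  map_one' := one_pow _
  map_mul' x y := mul_pow x y _
  map_zero' := zero_pow (pow_ne_zero _ (Fact.out : p.Prime).ne_zero)
  map_add' x y := by
    rcases subsingleton_or_nontrivial R with h | h
    · exact Subsingleton.elim _ _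
    · have : CharP R p := charP_of_injective_algebraMap (algebraMap k R).injective p
      have : ExpChar R p := ExpChar.prime Fact.out
      exact add_pow_expChar_pow x y p n

/-- The module `F^n_* R`: the additive group of `R`, on which `r ∈ R` acts as multiplication by
`r^{pⁿ}`. For reduced `R` this is the `R`-module `R^{1/pⁿ}` (via `x ↦ x^{1/pⁿ}`). -/
def FrobeniusPushforward (k : Type*) [Field k] (p : ℕ) [Fact p.Prime] [CharP k p] (_n : ℕ)
    (R : Type*) [CommRing R] [Algebra k R] : Type _ := R

instance (k : Type*) [Field k] (p : ℕ) [Fact p.Prime] [CharP k p] (n : ℕ)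
    (R : Type*) [CommRing R] [Algebra k R] : AddCommGroup (FrobeniusPushforward k p n R) :=
  inferInstanceAs (AddCommGroup R)

instance (k : Type*) [Field k] (p : ℕ) [Fact p.Prime] [CharP k p] (n : ℕ)
    (R : Type*) [CommRing R] [Algebra k R] : Module R (FrobeniusPushforward k p n R) :=
  Module.compHom R (frobeniusHom k p n R)

/-- The F-signature function `n ↦ frk_R(R^{1/pⁿ})`. -/
def fSignatureFun (k : Type*) [Field k] (p : ℕ) [Fact p.Prime] [CharP k p]
    (R : Type*) [CommRing R] [Algebra k R] (n : ℕ) : ℕ :=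
  freeRank R (FrobeniusPushforward k p n R)

/-- The normalised F-signature function `FS(n) / p^{n dim R}`. -/
def fSignatureRatio (k : Type*) [Field k] (p : ℕ) [Fact p.Prime] [CharP k p]
    (R : Type*) [CommRing R] [Algebra k R] (n : ℕ) : ℝ :=
  (fSignatureFun k p R n : ℝ) / (p : ℝ) ^ (krullDimNat R * n)

/-- The F-signature `lim FS(n) / p^{n dim R}`. -/
def fSignature (k : Type*) [Field k] (p : ℕ) [Fact p.Prime] [CharP k p]
    (R : Type*) [CommRing R] [Algebra k R] : ℝ := limUnder atTop (fSignatureRatio k p R)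

end Rings

/-! ### Weak `p`-fractals -/

/-- The set `𝓘 = [0,1] ∩ {a / p^m : a, m ∈ ℕ}`. -/
abbrev UnitPInterval (p : ℕ) : Type :=
  {t : ℚ // 0 ≤ t ∧ t ≤ 1 ∧ ∃ a m : ℕ, t = (a : ℚ) / (p : ℚ) ^ m}

/-- The set `𝓥 = {1 / p^m : m ∈ ℕ}`. -/
abbrev InvPowers (p : ℕ) : Type := {t : ℚ // ∃ m : ℕ, t = 1 / (p : ℚ) ^ m}

/-- The inclusion `𝓥 ⊆ 𝓘`. -/
def InvPowers.toInterval {p : ℕ} [Fact p.Prime] (v : InvPowers p) : UnitPInterval p :=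
  ⟨v.1, by
    obtain ⟨t, m, rfl⟩ := v
    have h1 : (1 : ℚ) ≤ (p : ℚ) ^ m :=
      one_le_pow₀ (by exact_mod_cast (Fact.out : p.Prime).one_lt.le)
    exact ⟨by positivity, (div_le_one (by positivity)).2 h1, 1, m, by simp⟩⟩

/-- The restriction of a function on `𝓘` to `𝓥`. -/
def restrict {p : ℕ} [Fact p.Prime] (φ : UnitPInterval p → ℚ) : InvPowers p → ℚ :=
  fun v => φ v.toInterval

/-- The operator `T_{pⁿ|0}` on `ℚ^𝓥`: `(T_{pⁿ|0} φ)(1/p^m) = φ(1/p^{m+n})`. -/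
def operatorT (p n : ℕ) : (InvPowers p → ℚ) →ₗ[ℚ] (InvPowers p → ℚ) where
  toFun φ v := φ ⟨v.1 / (p : ℚ) ^ n, by
    obtain ⟨t, m, rfl⟩ := v
    exact ⟨m + n, by rw [div_div, pow_add]⟩⟩
  map_add' _ _ := rfl
  map_smul' _ _ := rfl

/-- `φ ∈ ℚ^𝓥` is a weak `p`-fractal if it lies in a finite-dimensional subspace of `ℚ^𝓥` that is
stable under all the operators `T_{pⁿ|0}`. -/
def IsWeakPFractal (p : ℕ) (φ : InvPowers p → ℚ) : Prop :=
  ∃ V : Submodule ℚ (InvPowers p → ℚ),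
    FiniteDimensional ℚ V ∧ (∀ n : ℕ, ∀ ψ ∈ V, operatorT p n ψ ∈ V) ∧ φ ∈ V

/-! ### Hypersurfaces -/

section Hypersurfaces

variable {σ : Type*} {k : Type*} [Field k]

/-- `q^{-s} dim_k k⟦x_1, …, x_s⟧ / (x_1^q, …, x_s^q, f^a)`. -/
def normalizedColength [Fintype σ] (f : MvPowerSeries σ k) (a q : ℕ) : ℚ :=
  (Module.finrank k (MvPowerSeries σ k ⧸
    (Ideal.span (Set.range fun i : σ => (MvPowerSeries.X i : MvPowerSeries σ k) ^ q) ⊔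
      Ideal.span {f ^ a})) : ℚ) / (q : ℚ) ^ Fintype.card σ

/-- The function `φ_{f,p} : 𝓘 → ℚ`,
`a/pⁿ ↦ p^{-sn} dim_k k⟦x_1, …, x_s⟧ / (x_1^{pⁿ}, …, x_s^{pⁿ}, f^a)`.
The right-hand side does not depend on how an element of `𝓘` is written as `a/pⁿ` (the Frobenius
endomorphism is flat); here it is written in lowest terms, with denominator a power of `p`. -/
def phi [Fintype σ] (p : ℕ) (f : MvPowerSeries σ k) (t : UnitPInterval p) : ℚ :=
  normalizedColength f t.1.num.toNat t.1.den

theorem restrict_phi [Fintype σ] (p : ℕ) [Fact p.Prime] (f : MvPowerSeries σ k) (m : ℕ) :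
    restrict (phi p f) ⟨1 / (p : ℚ) ^ m, m, rfl⟩ = normalizedColength f 1 (p ^ m) := by
  have hp : 0 < p ^ m := pow_pos (Fact.out : p.Prime).pos m
  have h : (1 / (p : ℚ) ^ m) = ((p ^ m : ℕ) : ℚ)⁻¹ := by push_cast; rw [one_div]
  have hn : (1 / (p : ℚ) ^ m).num = 1 := by rw [h]; exact Rat.inv_natCast_num_of_pos hp
  have hd : (1 / (p : ℚ) ^ m).den = p ^ m := by rw [h]; exact Rat.inv_natCast_den_of_pos hp
  change normalizedColength f (1 / (p : ℚ) ^ m).num.toNat (1 / (p : ℚ) ^ m).den = _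
  rw [hn, hd]; rfl

/-- The hypersurface ring `k⟦x_1, …, x_s⟧ / (f)`. -/
abbrev Hypersurface (f : MvPowerSeries σ k) : Type _ := MvPowerSeries σ k ⧸ Ideal.span {f}

/-- The image in `k⟦x_1, …, x_s⟧ / (f)` of the maximal ideal of `k⟦x_1, …, x_s⟧`. For `f` in the
maximal ideal this is the unique maximal ideal of the local ring `k⟦x_1, …, x_s⟧ / (f)`. -/
def hypersurfaceMax (f : MvPowerSeries σ k) : Ideal (Hypersurface f) :=
  (IsLocalRing.maximalIdeal (MvPowerSeries σ k)).map (Ideal.Quotient.mk (Ideal.span {f}))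

theorem isLocalRing_hypersurface {f : MvPowerSeries σ k}
    (hf : f ∈ IsLocalRing.maximalIdeal (MvPowerSeries σ k)) :
    ∃ _ : IsLocalRing (Hypersurface f),
      IsLocalRing.maximalIdeal (Hypersurface f) = hypersurfaceMax f := by
  have hne : Ideal.span {f} ≠ ⊤ := by
    rw [Ne, Ideal.span_singleton_eq_top]
    exact (IsLocalRing.mem_maximalIdeal f).1 hf
  have : Nontrivial (Hypersurface f) := Ideal.Quotient.nontrivial_iff.2 hne
  have hloc : IsLocalRing (Hypersurface f) :=
    IsLocalRing.of_surjective' (Ideal.Quotient.mk (Ideal.span {f})) Ideal.Quotient.mk_surjective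
  refine ⟨hloc, ?_⟩
  exact (IsLocalRing.map_maximalIdeal_of_surjective _ Ideal.Quotient.mk_surjective).symm

/-- The Hilbert-Kunz function `HK_f` of `k⟦x_1, …, x_s⟧ / (f)`. -/
def HK (p : ℕ) (f : MvPowerSeries σ k) (n : ℕ) : ℕ := hilbertKunz p (hypersurfaceMax f) n

/-- The F-signature function `FS_f` of `k⟦x_1, …, x_s⟧ / (f)`. -/
def FS (p : ℕ) [Fact p.Prime] [CharP k p] (f : MvPowerSeries σ k) (n : ℕ) : ℕ :=
  fSignatureFun k p (Hypersurface f) n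

end Hypersurfaces

end HKProduct

end

open Filter Topology

noncomputable section

set_option linter.unusedSectionVars false

namespace HKProduct


/-! ### Sequences in finite-dimensional shift-stable spaces -/

/-! Write `q = p ^ n`. Modulo the `q`-th powers of its `s` variables a power series ring becomes a
`k`-space of dimension `q ^ s`, with the monomials having all exponents below `q` as a basis. Both
functions are read off from ranks of multiplication operators on this box. `HK_f(n)` is the
dimension of the cokernel of `f`, that is `q ^ s` minus the rank of `f` (`HK_eq_colength`,
`colength_add_mulRank`). For `f ≠ 0`, `FS_f(n)` is the rank of `f ^ (q - 1)` (`FS_eq_mulRank`). The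
latter is a Fedder-type argument: as `k` is perfect, `F^n_* A` is free over `A = k⟦x⟧` on the box
monomials, so linear forms on `F^n_* (A/f)` lift to linear forms on `F^n_* A`, and modulo `f` these
factor through multiplication by `f ^ (q - 1)`.

For disjoint sets of variables the box of the product ring is the tensor product of the two boxes,
and `fg` acts on it as `f ⊗ g`. Ranks therefore multiply (`mulRank_product`). Consequently `FS_{fg}
= FS_f FS_g` for nonzero `f`, `g`, always `HK_{fg} = q^{s'} HK_f + q^s HK_g - HK_f HK_g`, and
`φ_{fg} = φ_f + φ_g - φ_f φ_g` on `𝓥`.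

Parts (i)-(iii) become closure properties. Weak `p`-fractals and sequences with rational series are
both the sequences lying in a finite-dimensional shift-stable space; these are closed under sums,
differences and products and contain the geometric sequences. Polynomials in `p ^ n` with periodic
coefficients form an algebra. For (iv) and (v), the dimension of the product hypersurface is the sum
of the two dimensions plus one. After normalisation the product term is thus divided by an extra `p
^ n` and disappears in the limit. The normalised Hilbert-Kunz functions of `f` and `g` converge
because they are nondecreasing and bounded. -/

/-- The shift operator on sequences. -/
def shift : (ℕ → ℚ) →ₗ[ℚ] (ℕ → ℚ) := LinearMap.funLeft ℚ ℚ Nat.succ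

@[simp] theorem shift_apply (e : ℕ → ℚ) (n : ℕ) : shift e n = e (n + 1) := rfl

/-- `e` lies in a finite-dimensional subspace of `ℚ^ℕ` that is stable under the shift. -/
def IsShiftFinite (e : ℕ → ℚ) : Prop :=
  ∃ V : Submodule ℚ (ℕ → ℚ), FiniteDimensional ℚ V ∧ (∀ u ∈ V, shift u ∈ V) ∧ e ∈ V

theorem IsShiftFinite.add {e e' : ℕ → ℚ} (h : IsShiftFinite e) (h' : IsShiftFinite e') :
    IsShiftFinite (e + e') := by
  obtain ⟨V, _, hV, he⟩ := h
  obtain ⟨W, _, hW, he'⟩ := h'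
  refine ⟨V ⊔ W, inferInstance, fun u hu => ?_, Submodule.add_mem_sup he he'⟩
  obtain ⟨v, hv, w, hw, rfl⟩ := Submodule.mem_sup.1 hu
  rw [map_add]
  exact Submodule.add_mem_sup (hV v hv) (hW w hw)

/-- The shift is multiplicative for the pointwise product, so the product submodule `V * W` is again
stable, and it is finitely generated. -/
theorem IsShiftFinite.mul {e e' : ℕ → ℚ} (h : IsShiftFinite e) (h' : IsShiftFinite e') :
    IsShiftFinite (e * e') := by
  obtain ⟨V, hVf, hV, he⟩ := h
  obtain ⟨W, hWf, hW, he'⟩ := h'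
  refine ⟨V * W, Module.Finite.iff_fg.2 ((Module.Finite.iff_fg.1 hVf).mul
    (Module.Finite.iff_fg.1 hWf)), fun u hu => ?_, Submodule.mul_mem_mul he he'⟩
  induction hu using Submodule.mul_induction_on' with
  | mem_mul_mem v hv w hw => exact Submodule.mul_mem_mul (hV v hv) (hW w hw)
  | add x _ y _ hx hy => rw [map_add]; exact add_mem hx hy

theorem isShiftFinite_geometric (c a : ℚ) : IsShiftFinite fun n => c * a ^ n := by
  refine ⟨ℚ ∙ (fun n => a ^ n), inferInstance, fun u hu => ?_,
    Submodule.mem_span_singleton.2 ⟨c, rfl⟩⟩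
  obtain ⟨b, rfl⟩ := Submodule.mem_span_singleton.1 hu
  refine Submodule.mem_span_singleton.2 ⟨b * a, funext fun n => ?_⟩
  simp [pow_succ]; ring

theorem IsShiftFinite.sub {e e' : ℕ → ℚ} (h : IsShiftFinite e) (h' : IsShiftFinite e') :
    IsShiftFinite (e - e') := by
  have := h.add ((isShiftFinite_geometric (-1) 1).mul h')
  convert! this using 1
  ext n; simp [sub_eq_add_neg]

/-- Evaluation of functions on `𝓥` at the points `1 / p^m`. -/
def invPowersSeq (p : ℕ) [Fact p.Prime] : (InvPowers p → ℚ) ≃ₗ[ℚ] (ℕ → ℚ) :=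
  LinearEquiv.funCongrLeft ℚ ℚ <| Equiv.ofBijective (fun m : ℕ => ⟨1 / (p : ℚ) ^ m, m, rfl⟩) <| by
    refine ⟨fun a b h => ?_, fun ⟨t, m, h⟩ => ⟨m, Subtype.ext h.symm⟩⟩
    have h1 : (p : ℚ) ^ a = (p : ℚ) ^ b := by simpa using congrArg Subtype.val h
    exact Nat.pow_right_injective (Fact.out : p.Prime).two_le (by exact_mod_cast h1)

theorem invPowersSeq_apply (p : ℕ) [Fact p.Prime] (φ : InvPowers p → ℚ) (m : ℕ) :
    invPowersSeq p φ m = φ ⟨1 / (p : ℚ) ^ m, m, rfl⟩ := rfl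

theorem invPowersSeq_operatorT (p : ℕ) [Fact p.Prime] (φ : InvPowers p → ℚ) (n m : ℕ) :
    invPowersSeq p (operatorT p n φ) m = invPowersSeq p φ (m + n) := by
  simp only [invPowersSeq_apply, operatorT, LinearMap.coe_mk, AddHom.coe_mk]
  congr 2
  rw [div_div, pow_add]

/-- Under `1 / p ^ m ↔ m` the operator `T_{pⁿ|0}` becomes the `n`-th iterate of the shift, so
stability under the single operator with `n = 1` suffices. -/
theorem isWeakPFractal_iff (p : ℕ) [Fact p.Prime] (φ : InvPowers p → ℚ) :
    IsWeakPFractal p φ ↔ IsShiftFinite fun m => φ ⟨1 / (p : ℚ) ^ m, m, rfl⟩ := by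
  constructor
  · rintro ⟨V, _, hV, hφ⟩
    refine ⟨V.map (invPowersSeq p).toLinearMap, inferInstance, ?_, φ, hφ, rfl⟩
    rintro _ ⟨ψ, hψ, rfl⟩
    exact ⟨_, hV 1 ψ hψ, funext fun m => invPowersSeq_operatorT p ψ 1 m⟩
  · rintro ⟨V, _, hV, hφ⟩
    refine ⟨V.map (invPowersSeq p).symm.toLinearMap, inferInstance, ?_, _, hφ,
      (invPowersSeq p).symm_apply_apply φ⟩
    rintro n _ ⟨u, hu, rfl⟩
    have key : ∀ n, (fun m => u (m + n)) ∈ V := fun n => by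
      induction n with
      | zero => exact hu
      | succ n ih =>
        have := hV _ ih
        convert! this using 1
        ext m; simp [add_assoc, add_comm 1]
    refine ⟨_, key n, ?_⟩
    apply (invPowersSeq p).injective
    ext m
    rw [invPowersSeq_operatorT]
    simp

/-- The sequences `e` such that `Q · ∑ eₙ zⁿ` is a polynomial of degree less than `N`. -/
def polyMultiples (Q : Polynomial ℚ) (N : ℕ) : Submodule ℚ (ℕ → ℚ) where
  carrier := {e | ∀ n, N ≤ n → PowerSeries.coeff n ((Q : PowerSeries ℚ) * genSeries e) = 0}
  zero_mem' n _ := by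
    have : genSeries (0 : ℕ → ℚ) = 0 := by ext; simp [genSeries]
    simp [this]
  add_mem' {a b} ha hb n hn := by
    have : genSeries (a + b) = genSeries a + genSeries b := by ext; simp [genSeries]
    simp [this, mul_add, ha n hn, hb n hn]
  smul_mem' c a ha n hn := by
    have : genSeries (c • a) = c • genSeries a := by ext; simp [genSeries]
    simp [this, ha n hn]

/-- Power series over `ℚ` form a domain, so a sequence in this space is determined by the first `N`
coefficients of the product with `Q`. -/
theorem finiteDimensional_polyMultiples {Q : Polynomial ℚ} (hQ : Q ≠ 0) (N : ℕ) :
    FiniteDimensional ℚ (polyMultiples Q N) := by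
  let L : (polyMultiples Q N) →ₗ[ℚ] (Fin N → ℚ) :=
    { toFun := fun e i => PowerSeries.coeff i ((Q : PowerSeries ℚ) * genSeries e.1)
      map_add' := fun a b => by
        have : genSeries (a.1 + b.1) = genSeries a.1 + genSeries b.1 := by ext; simp [genSeries]
        ext; simp [this, mul_add]
      map_smul' := fun c a => by
        have : genSeries (c • a.1) = c • genSeries a.1 := by ext; simp [genSeries]
        ext; simp [this] }
  refine FiniteDimensional.of_injective L ((injective_iff_map_eq_zero L).2 fun e he => ?_)
  have h0 : (Q : PowerSeries ℚ) * genSeries e.1 = 0 := by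
    ext n
    by_cases hn : n < N
    · exact congrFun he ⟨n, hn⟩
    · simpa using e.2 n (not_lt.1 hn)
  have h1 : genSeries e.1 = 0 :=
    (mul_eq_zero.1 h0).resolve_left fun h => hQ (Polynomial.coe_inj.1 (by simpa using h))
  ext n
  simpa [genSeries] using congrArg (PowerSeries.coeff n) h1

/-- With `G = z G' + e₀`, where `G'` is the series of the shift, the coefficient of `Q G'` at `n`
equals that of `Q G` at `n + 1` up to `e₀` times a coefficient of `Q`; that coefficient vanishes
because `N` exceeds the degree of `Q`. -/
theorem shift_mem_polyMultiples {Q : Polynomial ℚ} {N : ℕ} (hN : Q.natDegree < N) {e : ℕ → ℚ}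
    (he : e ∈ polyMultiples Q N) : shift e ∈ polyMultiples Q N := by
  intro n hn
  have h1 : genSeries e = PowerSeries.X * genSeries (shift e) + PowerSeries.C (e 0) := by
    ext m
    cases m <;> simp [genSeries, PowerSeries.coeff_succ_X_mul]
  have h2 := he (n + 1) (by omega)
  rw [h1, mul_add, map_add, mul_left_comm, PowerSeries.coeff_succ_X_mul,
    PowerSeries.coeff_mul_C, Polynomial.coeff_coe,
    Polynomial.coeff_eq_zero_of_natDegree_lt (by omega)] at h2
  simpa using h2

theorem isRationalSeries_iff (e : ℕ → ℚ) : IsRationalSeries (genSeries e) ↔ IsShiftFinite e := by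
  constructor
  · rintro ⟨P, Q, hQ, h⟩
    refine ⟨polyMultiples Q (max P.natDegree Q.natDegree + 1),
      finiteDimensional_polyMultiples hQ _,
      fun u hu => shift_mem_polyMultiples (by omega) hu, fun n hn => ?_⟩
    rw [h, Polynomial.coeff_coe, Polynomial.coeff_eq_zero_of_natDegree_lt (by omega)]
  · rintro ⟨V, _, hV, he⟩
    -- By Cayley-Hamilton the characteristic polynomial of the shift on `V` yields a linear
    -- recurrence for `e`.
    let S : V →ₗ[ℚ] V := shift.restrict hV
    set χ := S.charpoly with hχ
    have hS : ∀ i : ℕ, ∀ n, ((S ^ i) ⟨e, he⟩).1 n = e (n + i) := fun i => by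
      induction i with
      | zero => intro n; rfl
      | succ i ih =>
        intro n
        rw [pow_succ', Module.End.mul_apply]
        exact (ih (n + 1)).trans (by congr 1; ring)
    have hrec : ∀ n, ∑ i ∈ Finset.range (χ.natDegree + 1), χ.coeff i * e (n + i) = 0 := fun n => by
      have h := congrArg (fun T : V →ₗ[ℚ] V => (T ⟨e, he⟩).1 n) S.aeval_self_charpoly
      simp only [← hχ, Polynomial.aeval_eq_sum_range] at h
      simpa [hS, LinearMap.sum_apply] using h
    -- The denominator is the reversed characteristic polynomial. The coefficient of its product
    -- with the series in degree `χ.natDegree + m` is the recurrence at `m`, so the product equals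
    -- its truncation.
    refine ⟨(PowerSeries.trunc χ.natDegree (χ.reverse * genSeries e)), χ.reverse, ?_, ?_⟩
    · rw [Ne, Polynomial.reverse_eq_zero]
      exact S.charpoly_monic.ne_zero
    · ext n
      rw [Polynomial.coeff_coe, PowerSeries.coeff_trunc]
      split_ifs with hn
      · rfl
      · obtain ⟨m, rfl⟩ := Nat.exists_eq_add_of_le (not_lt.1 hn)
        have hR : (χ.reverse : PowerSeries ℚ) = ((∑ i ∈ Finset.range (χ.natDegree + 1),
            Polynomial.monomial (χ.natDegree - i) (χ.coeff i) : Polynomial ℚ) : PowerSeries ℚ) := by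
          congr 1
          ext j
          rw [Polynomial.coeff_reverse, Polynomial.finsetSum_coeff]
          simp only [Polynomial.coeff_monomial]
          by_cases hj : j ≤ χ.natDegree
          · rw [Polynomial.revAt_le hj, Finset.sum_eq_single (χ.natDegree - j)]
            · rw [if_pos (by omega)]
            · intro i hi hij
              rw [if_neg]
              have := Finset.mem_range.1 hi
              omega
            · intro h; exact absurd (Finset.mem_range.2 (by omega)) h
          · rw [Polynomial.revAt_eq_self_of_lt (by omega), Finset.sum_eq_zero,
              Polynomial.coeff_eq_zero_of_natDegree_lt (by omega)]
            intro i hi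
            rw [if_neg (by omega)]
        rw [hR, ← hrec m, ← Polynomial.coeToPowerSeries.ringHom_apply, map_sum, Finset.sum_mul,
          map_sum]
        refine Finset.sum_congr rfl fun i hi => ?_
        have := Finset.mem_range.1 hi
        rw [Polynomial.coeToPowerSeries.ringHom_apply, Polynomial.coe_monomial,
          PowerSeries.monomial_eq_C_mul_X_pow, mul_assoc, PowerSeries.coeff_C_mul]
        rw [show χ.natDegree + m = (m + i) + (χ.natDegree - i) by omega,
          PowerSeries.coeff_X_pow_mul]
        simp [genSeries]

/-! ### Quasi-polynomials -/

/-- The algebra of periodic sequences. -/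
def periodicSeq : Subalgebra ℚ (ℕ → ℚ) where
  carrier := {a | ∃ M : ℕ, 1 ≤ M ∧ Function.Periodic a M}
  algebraMap_mem' c := ⟨1, le_rfl, fun _ => rfl⟩
  add_mem' := by
    rintro a b ⟨M, hM, ha⟩ ⟨N, hN, hb⟩
    refine ⟨M * N, Nat.mul_pos hM hN, ?_⟩
    have h1 := ha.nat_mul N
    have h2 := hb.nat_mul M
    simp only [Nat.cast_id] at h1 h2
    rw [mul_comm] at h1
    exact h1.add h2
  mul_mem' := by
    rintro a b ⟨M, hM, ha⟩ ⟨N, hN, hb⟩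
    refine ⟨M * N, Nat.mul_pos hM hN, ?_⟩
    have h1 := ha.nat_mul N
    have h2 := hb.nat_mul M
    simp only [Nat.cast_id] at h1 h2
    rw [mul_comm] at h1
    exact h1.mul h2

/-- The algebra of sequences that are polynomials in `pⁿ` with periodic coefficients. -/
def quasiPolynomials (p : ℕ) : Subalgebra periodicSeq (ℕ → ℚ) :=
  Algebra.adjoin periodicSeq {fun n => (p : ℚ) ^ n}

theorem pow_mem_quasiPolynomials (p s : ℕ) :
    (fun n => ((p : ℚ) ^ n) ^ s) ∈ quasiPolynomials p :=
  pow_mem (Algebra.subset_adjoin (Set.mem_singleton _) :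
    (fun n => (p : ℚ) ^ n) ∈ quasiPolynomials p) s

theorem IsQuasiPolynomial.mem {p : ℕ} {e : ℕ → ℚ} (h : IsQuasiPolynomial p e) :
    e ∈ quasiPolynomials p := by
  obtain ⟨d, a, ha, -, he⟩ := h
  have : e = ∑ i ∈ Finset.range (d + 1), a i * (fun n => (p : ℚ) ^ n) ^ i := by
    ext n
    simp [he, Finset.sum_apply, ← pow_mul, mul_comm]
  rw [this]
  refine sum_mem fun i hi => mul_mem ?_ (pow_mem_quasiPolynomials p i)
  have h := Subalgebra.algebraMap_mem (quasiPolynomials p)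
    ⟨a i, ha i (Nat.lt_succ_iff.1 (Finset.mem_range.1 hi))⟩
  exact h

/-- Elements of the algebra are values at `p ^ n` of polynomials with periodic coefficients. A
nonzero sequence forces the polynomial to be nonzero, and its leading coefficient is then not
identically zero. -/
theorem isQuasiPolynomial_of_mem {p : ℕ} {e : ℕ → ℚ} (h : e ∈ quasiPolynomials p) (h0 : e ≠ 0) :
    IsQuasiPolynomial p e := by
  rw [quasiPolynomials, Algebra.adjoin_singleton_eq_range_aeval] at h
  obtain ⟨P, rfl⟩ := h
  have hP : P ≠ 0 := fun h => h0 (by simp [h])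
  refine ⟨P.natDegree, fun i => (P.coeff i).1, fun i _ => (P.coeff i).2, ?_, fun n => ?_⟩
  · by_contra! h
    exact hP (Polynomial.leadingCoeff_eq_zero.1 (Subtype.ext (funext h)))
  · rw [AlgHom.toRingHom_eq_coe, RingHom.coe_coe, Polynomial.aeval_eq_sum_range]
    simp only [Finset.sum_apply]
    refine Finset.sum_congr rfl fun i _ => ?_
    rw [Algebra.smul_def, Pi.mul_apply, Pi.pow_apply, ← pow_mul, mul_comm n]
    rfl


/-! ### Multiplication operators on `k⟦x⟧ / (x^q)` -/

section Box

variable {σ : Type*} [Fintype σ] [DecidableEq σ] {k : Type*} [Field k]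

/-- The exponent vectors all of whose entries are less than `q`. -/
def boxExp {q : ℕ} (β : σ → Fin q) : σ →₀ ℕ := Finsupp.equivFunOnFinite.symm fun i => (β i : ℕ)

@[simp] theorem boxExp_apply {q : ℕ} (β : σ → Fin q) (i : σ) : boxExp β i = β i := rfl

theorem boxExp_injective {q : ℕ} : Function.Injective (boxExp : (σ → Fin q) → σ →₀ ℕ) :=
  fun _ _ h => funext fun i => Fin.ext (DFunLike.congr_fun h i)

theorem exists_boxExp {q : ℕ} {γ : σ →₀ ℕ} (h : ∀ i, γ i < q) : ∃ β : σ → Fin q, boxExp β = γ :=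
  ⟨fun i => ⟨γ i, h i⟩, by ext; rfl⟩

/-- The coefficients of a power series at the monomials with all exponents less than `q`. -/
def boxTrunc (σ : Type*) [Fintype σ] (k : Type*) [Field k] (q : ℕ) :
    MvPowerSeries σ k →ₗ[k] ((σ → Fin q) → k) :=
  LinearMap.pi fun β => MvPowerSeries.coeff (boxExp β)

theorem boxTrunc_apply (q : ℕ) (a : MvPowerSeries σ k) (β : σ → Fin q) :
    boxTrunc σ k q a β = MvPowerSeries.coeff (boxExp β) a := rfl

/-- The polynomial with given coefficients at the monomials with all exponents less than `q`. -/
def boxLift {q : ℕ} (v : (σ → Fin q) → k) : MvPowerSeries σ k :=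
  ∑ β, MvPowerSeries.monomial (boxExp β) (v β)

theorem boxTrunc_boxLift {q : ℕ} (v : (σ → Fin q) → k) :
    boxTrunc σ k q (boxLift v) = v := by
  ext γ
  rw [boxTrunc_apply, boxLift, map_sum, Finset.sum_eq_single γ]
  · simp
  · intro β _ hβ
    rw [MvPowerSeries.coeff_monomial, if_neg fun h => hβ (boxExp_injective h).symm]
  · simp

theorem boxTrunc_surjective (q : ℕ) : Function.Surjective (boxTrunc σ k q) := by
  exact fun v => ⟨_, boxTrunc_boxLift v⟩

/-- The ideal generated by the `q`-th powers of the variables. -/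
def varPowIdeal (σ : Type*) (k : Type*) [Field k] (q : ℕ) : Ideal (MvPowerSeries σ k) :=
  Ideal.span (Set.range fun i : σ => (MvPowerSeries.X i : MvPowerSeries σ k) ^ q)

theorem mem_varPowIdeal_iff {q : ℕ} {a : MvPowerSeries σ k} :
    a ∈ varPowIdeal σ k q ↔ boxTrunc σ k q a = 0 := by
  constructor
  · intro h
    induction h using Submodule.span_induction with
    | mem x hx =>
      obtain ⟨i, rfl⟩ := hx
      ext β
      rw [boxTrunc_apply]
      exact MvPowerSeries.X_pow_dvd_iff.1 dvd_rfl _ (β i).2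
    | zero => exact map_zero _
    | add x y _ _ hx hy => rw [map_add, hx, hy, add_zero]
    -- Every monomial dividing a box monomial lies in the box, so the box coefficients of `c * x`
    -- involve only those of `x`.
    | smul c x _ hx =>
      ext β
      rw [boxTrunc_apply, smul_eq_mul, MvPowerSeries.coeff_mul]
      refine Finset.sum_eq_zero fun u hu => ?_
      have hu' : u.1 + u.2 = boxExp β := Finset.HasAntidiagonal.mem_antidiagonal.1 hu
      obtain ⟨δ, hδ⟩ := exists_boxExp (q := q) (γ := u.2) fun i => by
        have := DFunLike.congr_fun hu' i
        simp only [Finsupp.add_apply, boxExp_apply] at this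
        have := (β i).2
        omega
      rw [← hδ, ← boxTrunc_apply, hx, Pi.zero_apply, mul_zero]
  · intro h
    -- Each exponent outside the box is assigned to one variable whose exponent is at least `q`.
    -- This splits `a` into finitely many series `b i`, each divisible by `X i ^ q`.
    let c : (σ →₀ ℕ) → Option σ := fun γ =>
      if h : ∃ i, q ≤ γ i then some h.choose else none
    let b : σ → MvPowerSeries σ k := fun i γ =>
      if c γ = some i then MvPowerSeries.coeff γ a else 0
    have hb : ∀ i γ, MvPowerSeries.coeff γ (b i) =
      if c γ = some i then MvPowerSeries.coeff γ a else 0 := fun _ _ => rfl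
    have hsum : a = ∑ i, b i := by
      ext γ
      rw [map_sum]
      simp only [hb]
      by_cases hγ : ∃ i, q ≤ γ i
      · simp [c, hγ]
      · simp only [c, hγ]
        push Not at hγ
        obtain ⟨β, rfl⟩ := exists_boxExp hγ
        simpa [boxTrunc_apply] using congrFun h β
    rw [hsum]
    refine sum_mem fun i _ => ?_
    refine Ideal.mem_of_dvd _ ?_ (Ideal.subset_span ⟨i, rfl⟩)
    refine MvPowerSeries.X_pow_dvd_iff.2 fun γ hγ => ?_
    rw [hb, if_neg]
    intro hc
    by_cases h' : ∃ i, q ≤ γ i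
    · simp only [c, h', dif_pos, Option.some.injEq] at hc
      have := h'.choose_spec
      rw [hc] at this
      omega
    · simp [c, h'] at hc

/-- The matrix of multiplication by `f` on `k⟦x⟧ / (x^q)` in the monomial basis. -/
def mulMatrix (f : MvPowerSeries σ k) (q : ℕ) : Matrix (σ → Fin q) (σ → Fin q) k :=
  open Classical in
  Matrix.of fun γ β =>
    if boxExp β ≤ boxExp γ then MvPowerSeries.coeff (boxExp γ - boxExp β) f else 0

theorem mulMatrix_apply (f : MvPowerSeries σ k) (q : ℕ) (γ β : σ → Fin q)
    [Decidable (boxExp β ≤ boxExp γ)] : mulMatrix f q γ β =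
      if boxExp β ≤ boxExp γ then MvPowerSeries.coeff (boxExp γ - boxExp β) f else 0 := by
  rw [mulMatrix, Matrix.of_apply]
  congr

theorem boxTrunc_mul (f a : MvPowerSeries σ k) (q : ℕ) :
    boxTrunc σ k q (f * a) = (mulMatrix f q).mulVec (boxTrunc σ k q a) := by
  have h1 : a - boxLift (boxTrunc σ k q a) ∈ varPowIdeal σ k q := by
    rw [mem_varPowIdeal_iff, map_sub, boxTrunc_boxLift, sub_self]
  have h2 := Ideal.mul_mem_left _ f h1
  rw [mul_sub, mem_varPowIdeal_iff, map_sub, sub_eq_zero] at h2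
  rw [h2]
  ext γ
  rw [boxTrunc_apply, boxLift, Finset.mul_sum, map_sum, Matrix.mulVec, dotProduct]
  refine Finset.sum_congr rfl fun β _ => ?_
  rw [MvPowerSeries.coeff_mul_monomial, mulMatrix_apply, ite_mul, zero_mul]

theorem mulMatrix_mul (f g : MvPowerSeries σ k) (q : ℕ) :
    mulMatrix (f * g) q = mulMatrix f q * mulMatrix g q := by
  refine Matrix.ext_of_mulVec_single fun β => ?_
  obtain ⟨a, ha⟩ := boxTrunc_surjective (σ := σ) (k := k) q (Pi.single β 1)
  rw [← ha, ← Matrix.mulVec_mulVec, ← boxTrunc_mul, ← boxTrunc_mul, ← boxTrunc_mul, mul_assoc]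

/-- The rank of multiplication by `f` on `k⟦x⟧ / (x^q)`. -/
def mulRank (f : MvPowerSeries σ k) (q : ℕ) : ℕ := (mulMatrix f q).rank

/-- The dimension of `k⟦x⟧ / (x^q, f)`. -/
def colength (f : MvPowerSeries σ k) (q : ℕ) : ℕ :=
  Module.finrank k (MvPowerSeries σ k ⧸ (varPowIdeal σ k q ⊔ Ideal.span {f}))

theorem mem_sup_span_iff (f : MvPowerSeries σ k) (q : ℕ) (a : MvPowerSeries σ k) :
    a ∈ varPowIdeal σ k q ⊔ Ideal.span {f} ↔
      boxTrunc σ k q a ∈ LinearMap.range (mulMatrix f q).mulVecLin := by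
  constructor
  · intro h
    obtain ⟨u, hu, v, hv, rfl⟩ := Submodule.mem_sup.1 h
    obtain ⟨c, rfl⟩ := Ideal.mem_span_singleton.1 hv
    exact ⟨boxTrunc σ k q c, by
      rw [map_add, mem_varPowIdeal_iff.1 hu, zero_add, boxTrunc_mul, Matrix.mulVecLin_apply]⟩
  · rintro ⟨v, hv⟩
    obtain ⟨c, rfl⟩ := boxTrunc_surjective (σ := σ) (k := k) q v
    rw [Matrix.mulVecLin_apply, ← boxTrunc_mul] at hv
    have : a = (a - f * c) + f * c := by ring
    rw [this]
    refine Submodule.add_mem_sup ?_ (Ideal.mem_span_singleton.2 (dvd_mul_right f c))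
    rw [mem_varPowIdeal_iff, map_sub, hv, sub_self]

/-- `k⟦x⟧ / (x^q, f)` is the cokernel of multiplication by `f` on `k⟦x⟧ / (x^q)`. -/
def quotientEquiv (f : MvPowerSeries σ k) (q : ℕ) :
    (MvPowerSeries σ k ⧸ (varPowIdeal σ k q ⊔ Ideal.span {f})) ≃ₗ[k]
      (((σ → Fin q) → k) ⧸ LinearMap.range (mulMatrix f q).mulVecLin) :=
  ((Submodule.Quotient.restrictScalarsEquiv k (varPowIdeal σ k q ⊔ Ideal.span {f})).symm.trans
    (Submodule.quotEquivOfEq _ _ <| by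
      ext a
      rw [Submodule.restrictScalars_mem, mem_sup_span_iff, LinearMap.mem_ker,
        LinearMap.comp_apply, Submodule.mkQ_apply, Submodule.Quotient.mk_eq_zero])).trans
    (LinearMap.quotKerEquivOfSurjective
      ((LinearMap.range (mulMatrix f q).mulVecLin).mkQ ∘ₗ boxTrunc σ k q)
      ((Submodule.mkQ_surjective _).comp (boxTrunc_surjective q)))

theorem finiteDimensional_quotient (f : MvPowerSeries σ k) (q : ℕ) :
    FiniteDimensional k (MvPowerSeries σ k ⧸ (varPowIdeal σ k q ⊔ Ideal.span {f})) :=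
  (quotientEquiv f q).symm.finiteDimensional

theorem colength_add_mulRank (f : MvPowerSeries σ k) (q : ℕ) :
    colength f q + mulRank f q = q ^ Fintype.card σ := by
  rw [colength, (quotientEquiv f q).finrank_eq, mulRank, Matrix.rank,
    Submodule.finrank_quotient_add_finrank]
  simp

end Box


/-! ### Ranks of Kronecker products and base changes, kernels of composites -/

section MatrixRank

variable {k : Type*} [Field k]

-- A tensor product of maps factors as a surjection followed by an injection through the tensor
-- product of the two ranges; injectivity holds by flatness over a field.
open scoped Kronecker TensorProduct in
theorem rank_kronecker {m n : Type*} [Fintype m] [Fintype n] [DecidableEq m]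
    [DecidableEq n] (A : Matrix m m k) (B : Matrix n n k) : (A ⊗ₖ B).rank = A.rank * B.rank := by
  let bm := Pi.basisFun k m
  let bn := Pi.basisFun k n
  rw [Matrix.rank_eq_finrank_range_toLin A bm bm, Matrix.rank_eq_finrank_range_toLin B bn bn,
    Matrix.rank_eq_finrank_range_toLin _ (bm.tensorProduct bn) (bm.tensorProduct bn),
    Matrix.toLin_kronecker]
  set a := Matrix.toLin bm bm A
  set b := Matrix.toLin bn bn B
  have h : TensorProduct.map a b =
      TensorProduct.map (LinearMap.range a).subtype (LinearMap.range b).subtype ∘ₗ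
        TensorProduct.map a.rangeRestrict b.rangeRestrict := by
    rw [← TensorProduct.map_comp]
    rfl
  have hs : LinearMap.range (TensorProduct.map a.rangeRestrict b.rangeRestrict) = ⊤ :=
    LinearMap.range_eq_top.2 (TensorProduct.map_surjective a.surjective_rangeRestrict
      b.surjective_rangeRestrict)
  rw [h, LinearMap.range_comp_of_range_eq_top _ hs, LinearMap.finrank_range_of_inj,
    Module.finrank_tensorProduct]
  exact TensorProduct.map_injective_of_flat_flat _ _ (Submodule.injective_subtype _)
    (Submodule.injective_subtype _)

/-- The rank normal form `V A U` has entries `0` and `1` only, so it is preserved by `φ`, and `φ`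
keeps `V` and `U` invertible. This is applied to the Frobenius of `k`. -/
theorem rank_map_ringHom {l : Type*} [Field l] {m : Type*} [Fintype m] [DecidableEq m] (φ : k →+* l)
    (A : Matrix m m k) : (A.map φ).rank = A.rank := by
  obtain ⟨V, U, e, hV, hU, h⟩ := A.exists_rank_normal_form
  have h' : V.map φ * A.map φ * U.map φ =
      (Matrix.fromBlocks 1 0 0 0 : Matrix (Fin A.rank ⊕ Fin (Fintype.card m - A.rank)) _ l).submatrix
        e e := by
    rw [← Matrix.map_mul, ← Matrix.map_mul, h, ← Matrix.submatrix_map, Matrix.fromBlocks_map]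
    simp
  have hdet : ∀ W : Matrix m m k, IsUnit W → IsUnit (W.map φ).det := fun W hW => by
    have := ((Matrix.isUnit_iff_isUnit_det _).1 hW).map φ
    rwa [RingHom.map_det] at this
  rw [← Matrix.rank_mul_eq_right_of_isUnit_det _ (A.map φ) (hdet V hV),
    ← Matrix.rank_mul_eq_left_of_isUnit_det _ (V.map φ * A.map φ) (hdet U hU), h',
    Matrix.rank_submatrix]
  have : (Matrix.fromBlocks 1 0 0 0 : Matrix (Fin A.rank ⊕ Fin (Fintype.card m - A.rank)) _ l) =
      Matrix.diagonal (Sum.elim (fun _ => 1) fun _ => 0) := by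
    ext (i | i) (j | j) <;> simp [Matrix.diagonal_apply, Matrix.one_apply]
  classical
  rw [this, Matrix.rank_diagonal]
  have e : {i : Fin A.rank ⊕ Fin (Fintype.card m - A.rank) //
      Sum.elim (fun _ => (1 : l)) (fun _ => 0) i ≠ 0} ≃ Fin A.rank :=
    { toFun := fun i => match i with
        | ⟨.inl i, _⟩ => i
        | ⟨.inr _, h⟩ => absurd rfl h
      invFun := fun i => ⟨.inl i, one_ne_zero⟩
      left_inv := by
        rintro ⟨i | i, h⟩
        · rfl
        · exact absurd rfl h
      right_inv := fun _ => rfl }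
  rw [Fintype.card_congr e, Fintype.card_fin]

theorem finrank_ker_comp_le {V : Type*} [AddCommGroup V] [Module k V] [FiniteDimensional k V]
    (a b : V →ₗ[k] V) : Module.finrank k (LinearMap.ker (a ∘ₗ b)) ≤
      Module.finrank k (LinearMap.ker a) + Module.finrank k (LinearMap.ker b) := by
  let L := b.domRestrict (LinearMap.ker (a ∘ₗ b))
  rw [← L.finrank_range_add_finrank_ker]
  refine add_le_add (Submodule.finrank_mono ?_) ?_
  · rintro _ ⟨v, rfl⟩
    exact v.2
  · refine LinearMap.finrank_le_finrank_of_injective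
      (f := ((LinearMap.ker (a ∘ₗ b)).subtype ∘ₗ (LinearMap.ker L).subtype).codRestrict
        (LinearMap.ker b) fun v => v.2) ?_
    intro v w hvw
    exact Subtype.ext (Subtype.ext (congrArg (LinearMap.ker b).subtype hvw))

end MatrixRank

/-! ### Colengths of products and of Frobenius powers -/

section Colength

variable {σ : Type*} [Fintype σ] [DecidableEq σ] {k : Type*} [Field k]

theorem colength_eq_finrank_ker (f : MvPowerSeries σ k) (q : ℕ) :
    colength f q = Module.finrank k (LinearMap.ker (mulMatrix f q).mulVecLin) := by
  have h1 := colength_add_mulRank f q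
  have h2 := (mulMatrix f q).mulVecLin.finrank_range_add_finrank_ker
  rw [← Matrix.rank] at h2
  rw [mulRank] at h1
  simp only [Module.finrank_fintype_fun_eq_card, Fintype.card_fun, Fintype.card_fin] at h2
  omega

theorem colength_mul_le (f g : MvPowerSeries σ k) (q : ℕ) :
    colength (f * g) q ≤ colength f q + colength g q := by
  rw [colength_eq_finrank_ker, mulMatrix_mul, Matrix.mulVecLin_mul, colength_eq_finrank_ker f,
    colength_eq_finrank_ker g]
  exact finrank_ker_comp_le _ _

theorem colength_pow_succ_le (f : MvPowerSeries σ k) (a q : ℕ) :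
    colength (f ^ (a + 1)) q ≤ (a + 1) * colength f q := by
  induction a with
  | zero => simp
  | succ a ih =>
    rw [pow_succ, add_mul _ 1, one_mul]
    exact (colength_mul_le _ _ _).trans (by gcongr)

variable {p : ℕ} [Fact p.Prime] [CharP k p]

theorem coeff_smul_pow_char (f : MvPowerSeries σ k) (n : ℕ) (γ : σ →₀ ℕ) :
    MvPowerSeries.coeff (p ^ n • γ) (f ^ p ^ n) = MvPowerSeries.coeff γ f ^ p ^ n := by
  have := ExpChar.prime (R := k) (Fact.out : p.Prime)
  rw [← MvPowerSeries.map_iterateFrobenius_expand p (Fact.out : p.Prime).ne_zero f n,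
    MvPowerSeries.coeff_map, MvPowerSeries.coeff_expand_smul, iterateFrobenius_def]

theorem coeff_pow_char_of_not_dvd (f : MvPowerSeries σ k) (n : ℕ) {γ : σ →₀ ℕ} {i : σ}
    (h : ¬ p ^ n ∣ γ i) : MvPowerSeries.coeff γ (f ^ p ^ n) = 0 := by
  have := ExpChar.prime (R := k) (Fact.out : p.Prime)
  rw [← MvPowerSeries.map_iterateFrobenius_expand p (Fact.out : p.Prime).ne_zero f n,
    MvPowerSeries.coeff_map, MvPowerSeries.coeff_expand_of_not_dvd _ _ _ h, map_zero]

/-- Division with remainder by `r` of exponent vectors with entries less than `q * r`. -/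
def boxDivMod (σ : Type*) (q r : ℕ) : (σ → Fin q) × (σ → Fin r) ≃ (σ → Fin (q * r)) :=
  (Equiv.arrowProdEquivProdArrow σ (fun _ => Fin q) fun _ => Fin r).symm.trans
    (Equiv.arrowCongr (Equiv.refl σ) finProdFinEquiv)

theorem boxExp_boxDivMod (q r : ℕ) (x : (σ → Fin q) × (σ → Fin r)) :
    boxExp (boxDivMod σ q r x) = boxExp x.2 + r • boxExp x.1 := by
  ext i
  rfl

-- All exponents occurring in `f ^ p ^ n` are divisible by `p ^ n`, so multiplication by it
-- preserves the remainder of an exponent modulo `p ^ n`. On the quotients it acts as `f` with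
-- coefficients raised to the power `p ^ n`.
open scoped Kronecker in
theorem mulMatrix_pow_char (f : MvPowerSeries σ k) (n q : ℕ) :
    (mulMatrix (f ^ p ^ n) (q * p ^ n)).submatrix (boxDivMod σ q (p ^ n))
      (boxDivMod σ q (p ^ n)) =
      (mulMatrix f q).map (iterateFrobenius k p n) ⊗ₖ (1 : Matrix (σ → Fin (p ^ n)) _ k) := by
  have hp : 0 < p ^ n := pow_pos (Fact.out : p.Prime).pos n
  have hc := Classical.decRel (fun a b : σ →₀ ℕ => a ≤ b)
  ext ⟨γ, ρ⟩ ⟨β, τ⟩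
  rw [Matrix.submatrix_apply, Matrix.kroneckerMap_apply, Matrix.map_apply, mulMatrix_apply,
    mulMatrix_apply, boxExp_boxDivMod, boxExp_boxDivMod, iterateFrobenius_def, Matrix.one_apply]
  dsimp only
  by_cases hρ : ρ = τ
  · subst hρ
    have h1 : boxExp ρ + p ^ n • boxExp β ≤ boxExp ρ + p ^ n • boxExp γ ↔
        boxExp β ≤ boxExp γ := by
      rw [add_le_add_iff_left]
      constructor
      · intro h i
        have := h i
        simp only [Finsupp.smul_apply, smul_eq_mul] at this
        exact Nat.le_of_mul_le_mul_left this hp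
      · intro h
        exact nsmul_le_nsmul_right h _
    rw [if_pos rfl, mul_one]
    by_cases h : boxExp β ≤ boxExp γ
    · rw [if_pos h, if_pos (h1.2 h), add_tsub_add_eq_tsub_left, ← coeff_smul_pow_char]
      congr 2
      ext i
      simp [Nat.mul_sub]
    · rw [if_neg h, if_neg (h ∘ h1.1), zero_pow hp.ne']
  · rw [if_neg hρ, mul_zero]
    split_ifs with h
    · obtain ⟨i, hi⟩ := Function.ne_iff.1 hρ
      refine coeff_pow_char_of_not_dvd f n (i := i) fun hd => hi ?_
      have hle := h i
      simp only [Finsupp.coe_tsub, Finsupp.coe_add, Pi.sub_apply, Pi.add_apply, boxExp_apply,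
        Finsupp.smul_apply, smul_eq_mul] at hd hle
      have hmod := (Nat.modEq_iff_dvd' hle).2 hd
      have h2 : (τ i : ℕ) ≡ ρ i [MOD p ^ n] := by
        simpa [Nat.ModEq] using hmod
      rw [Nat.ModEq, Nat.mod_eq_of_lt (τ i).2, Nat.mod_eq_of_lt (ρ i).2] at h2
      exact Fin.ext h2.symm
    · rfl

theorem mulRank_pow_char (f : MvPowerSeries σ k) (n q : ℕ) :
    mulRank (f ^ p ^ n) (q * p ^ n) = mulRank f q * (p ^ n) ^ Fintype.card σ := by
  rw [mulRank, ← Matrix.rank_submatrix _ (boxDivMod σ q (p ^ n)) (boxDivMod σ q (p ^ n)),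
    mulMatrix_pow_char, rank_kronecker, rank_map_ringHom, Matrix.rank_one]
  simp [mulRank]

theorem colength_pow_char (f : MvPowerSeries σ k) (n q : ℕ) :
    colength (f ^ p ^ n) (q * p ^ n) = colength f q * (p ^ n) ^ Fintype.card σ := by
  have h1 := colength_add_mulRank (f ^ p ^ n) (q * p ^ n)
  rw [mulRank_pow_char, mul_pow, ← colength_add_mulRank f q, add_mul] at h1
  exact Nat.add_right_cancel h1

/-- The function `n ↦ dim k⟦x⟧ / (x^{pⁿ}, f)`, divided by `p^{n(s-1)}`, is nondecreasing. -/
theorem colength_mul_le_succ (f : MvPowerSeries σ k) (n : ℕ) :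
    colength f (p ^ n) * p ^ Fintype.card σ ≤ p * colength f (p ^ (n + 1)) := by
  -- The colength of `f ^ p` in the box of side `p ^ (n + 1)` is exactly `p ^ s` times that of `f`
  -- in the box of side `p ^ n`, and by subadditivity it is at most `p` times that of `f` in the
  -- larger box.
  have h := colength_pow_char (p := p) f 1 (p ^ n)
  rw [pow_one, ← pow_succ] at h
  rw [← h]
  obtain ⟨a, ha⟩ := Nat.exists_eq_succ_of_ne_zero (Fact.out : p.Prime).ne_zero
  have := colength_pow_succ_le f a (p ^ (n + 1))
  rwa [← Nat.succ_eq_add_one, ← ha] at this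

end Colength

/-! ### Growth of the colength -/

section Bound

variable {σ : Type*} [Fintype σ] [LinearOrder σ] {k : Type*} [Field k]

/-- Let `α` be the lexicographically smallest exponent of `f`. A nonzero polynomial with exponents
`β i < q - α i` and smallest exponent `d` has a product with `f` with nonzero coefficient at `α +
d`, still inside the box. Hence multiplication by `f` is injective modulo `(x^q)` on the space of
such polynomials. -/
theorem prod_sub_le_mulRank {f : MvPowerSeries σ k} {α : σ →₀ ℕ}
    (hα : f.lexOrder = ((toLex α : Lex (σ →₀ ℕ)) : WithTop (Lex (σ →₀ ℕ)))) (q : ℕ) :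
    ∏ i, (q - α i) ≤ mulRank f q := by
  let ex : ((i : σ) → Fin (q - α i)) → σ →₀ ℕ := fun β =>
    Finsupp.equivFunOnFinite.symm fun i => (β i : ℕ)
  have hex : Function.Injective ex := fun _ _ h => funext fun i => Fin.ext (DFunLike.congr_fun h i)
  let L : (((i : σ) → Fin (q - α i)) → k) →ₗ[k] MvPowerSeries σ k :=
    ∑ β, MvPowerSeries.monomial (ex β) ∘ₗ LinearMap.proj β
  have hL : ∀ v β, MvPowerSeries.coeff (ex β) (L v) = v β := fun v β => by
    simp only [L, LinearMap.sum_apply, LinearMap.comp_apply, LinearMap.proj_apply, map_sum,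
      MvPowerSeries.coeff_monomial]
    rw [Finset.sum_eq_single β]
    · simp
    · intro γ _ hγ
      rw [if_neg fun h => hγ (hex h).symm]
    · simp
  have hL' : ∀ v γ, MvPowerSeries.coeff γ (L v) ≠ 0 → ∃ β, ex β = γ := fun v γ h => by
    simp only [L, LinearMap.sum_apply, LinearMap.comp_apply, LinearMap.proj_apply, map_sum,
      MvPowerSeries.coeff_monomial] at h
    obtain ⟨β, -, hβ⟩ := Finset.exists_ne_zero_of_sum_ne_zero h
    exact ⟨β, by by_contra h'; exact hβ (if_neg fun h => h' h.symm)⟩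
  let T := boxTrunc σ k q ∘ₗ LinearMap.mulLeft k f ∘ₗ L
  have hT : Function.Injective T := by
    refine (injective_iff_map_eq_zero T).2 fun v hv => ?_
    by_contra hv0
    have hLv : L v ≠ 0 := fun h => hv0 (funext fun β => by rw [← hL v β, h]; simp)
    obtain ⟨d, hd⟩ := MvPowerSeries.exists_finsupp_eq_lexOrder_of_ne_zero hLv
    have hd0 := MvPowerSeries.coeff_ne_zero_of_lexOrder hd.symm
    obtain ⟨β, rfl⟩ := hL' v d hd0
    have h1 := MvPowerSeries.coeff_mul_of_add_lexOrder hα hd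
    obtain ⟨γ, hγ⟩ := exists_boxExp (q := q) (γ := α + ex β) fun i => by
      have := (β i).2
      simp only [Finsupp.add_apply, ex, Finsupp.equivFunOnFinite_symm_apply_apply]
      omega
    have h2 := congrFun hv γ
    change MvPowerSeries.coeff (boxExp γ) (f * L v) = 0 at h2
    rw [hγ, h1] at h2
    exact (mul_ne_zero (MvPowerSeries.coeff_ne_zero_of_lexOrder hα.symm) hd0) h2
  have h1 := LinearMap.finrank_range_of_inj hT
  have h2 : LinearMap.range T ≤ LinearMap.range (mulMatrix f q).mulVecLin := by
    rintro _ ⟨v, rfl⟩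
    exact ⟨_, (boxTrunc_mul f (L v) q).symm⟩
  have h3 := Submodule.finrank_mono h2
  rw [h1] at h3
  simpa [mulRank, Matrix.rank] using h3

/-- This is `q^s - ∏ (q - αᵢ) ≤ (∑ αᵢ) q^{s-1}`, multiplied by `q` and rearranged so that no
exponent `s - 1` or outer subtraction occurs in `ℕ`. -/
theorem pow_card_le_prod_sub_add (q : ℕ) (α : σ → ℕ) :
    q * q ^ Fintype.card σ ≤ q * ∏ i, (q - α i) + (∑ i, α i) * q ^ Fintype.card σ := by
  have key : ∀ S : Finset σ,
      q * q ^ S.card ≤ q * ∏ i ∈ S, (q - α i) + (∑ i ∈ S, α i) * q ^ S.card := fun S => by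
    induction S using Finset.induction_on with
    | empty => simp
    | insert j S hj ih =>
      rw [Finset.card_insert_of_notMem hj, Finset.prod_insert hj, Finset.sum_insert hj, pow_succ]
      have h1 : q ≤ (q - α j) + α j := by omega
      have h2 : ∏ i ∈ S, (q - α i) ≤ q ^ S.card :=
        Finset.prod_le_pow_card _ _ _ fun i _ => Nat.sub_le _ _
      calc q * (q ^ S.card * q) = (q * q ^ S.card) * q := by ring
        _ ≤ (q * ∏ i ∈ S, (q - α i) + (∑ i ∈ S, α i) * q ^ S.card) * q := by gcongr
        _ = q * (q * ∏ i ∈ S, (q - α i)) + (∑ i ∈ S, α i) * (q ^ S.card * q) := by ring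
        _ ≤ q * (((q - α j) + α j) * ∏ i ∈ S, (q - α i)) +
            (∑ i ∈ S, α i) * (q ^ S.card * q) := by gcongr
        _ = q * ((q - α j) * ∏ i ∈ S, (q - α i)) + q * (α j * ∏ i ∈ S, (q - α i)) +
            (∑ i ∈ S, α i) * (q ^ S.card * q) := by ring
        _ ≤ q * ((q - α j) * ∏ i ∈ S, (q - α i)) + q * (α j * q ^ S.card) +
            (∑ i ∈ S, α i) * (q ^ S.card * q) := by gcongr
        _ = _ := by ring
  exact key Finset.univ

theorem exists_colength_mul_le {f : MvPowerSeries σ k} (hf : f ≠ 0) :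
    ∃ C : ℕ, ∀ q, colength f q * q ≤ C * q ^ Fintype.card σ := by
  obtain ⟨α, hα⟩ := MvPowerSeries.exists_finsupp_eq_lexOrder_of_ne_zero hf
  refine ⟨∑ i, α i, fun q => ?_⟩
  have h1 := prod_sub_le_mulRank hα q
  have h2 := colength_add_mulRank f q
  have h3 := pow_card_le_prod_sub_add q α
  have h4 : q * q ^ Fintype.card σ ≤ q * mulRank f q + (∑ i, α i) * q ^ Fintype.card σ :=
    h3.trans (by gcongr)
  rw [← h2, mul_add] at h4
  rw [h2] at h4
  linarith

end Bound

/-! ### Multiplicativity of the rank for disjoint sets of variables -/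

section Product

variable {σ τ : Type*} [Fintype σ] [DecidableEq σ] [Fintype τ] [DecidableEq τ]
  {k : Type*} [Field k]

/-- The exponent vector on `σ ⊕ τ` with given components. -/
def sumExp (u : σ →₀ ℕ) (v : τ →₀ ℕ) : σ ⊕ τ →₀ ℕ := u.mapDomain .inl + v.mapDomain .inr

theorem sumExp_inl (u : σ →₀ ℕ) (v : τ →₀ ℕ) (i : σ) : sumExp u v (.inl i) = u i := by
  have h := Finsupp.mapDomain_of_notMem_range (f := (Sum.inr : τ → σ ⊕ τ)) v (.inl i) (by simp)
  rw [sumExp, Finsupp.add_apply, Finsupp.mapDomain_apply Sum.inl_injective, h, add_zero]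

theorem sumExp_inr (u : σ →₀ ℕ) (v : τ →₀ ℕ) (i : τ) : sumExp u v (.inr i) = v i := by
  have h := Finsupp.mapDomain_of_notMem_range (f := (Sum.inl : σ → σ ⊕ τ)) u (.inr i) (by simp)
  rw [sumExp, Finsupp.add_apply, Finsupp.mapDomain_apply Sum.inr_injective, h, zero_add]

theorem sumExp_le_iff {u u' : σ →₀ ℕ} {v v' : τ →₀ ℕ} :
    sumExp u v ≤ sumExp u' v' ↔ u ≤ u' ∧ v ≤ v' := by
  constructor
  · intro h
    exact ⟨fun i => by simpa [sumExp_inl] using h (.inl i),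
      fun i => by simpa [sumExp_inr] using h (.inr i)⟩
  · rintro ⟨h, h'⟩ (i | i)
    · simpa [sumExp_inl] using h i
    · simpa [sumExp_inr] using h' i

theorem sumExp_sub (u u' : σ →₀ ℕ) (v v' : τ →₀ ℕ) :
    sumExp u v - sumExp u' v' = sumExp (u - u') (v - v') := by
  ext (i | i) <;> simp [sumExp_inl, sumExp_inr]

/-- An exponent on `σ ⊕ τ` has only one decomposition into a part supported on `σ` and a part
supported on `τ`, so a single term of the convolution survives. -/
theorem coeff_rename_inl_mul_rename_inr (f : MvPowerSeries σ k) (g : MvPowerSeries τ k)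
    (u : σ →₀ ℕ) (v : τ →₀ ℕ) :
    MvPowerSeries.coeff (sumExp u v)
      (MvPowerSeries.rename Sum.inl f * MvPowerSeries.rename Sum.inr g) =
      MvPowerSeries.coeff u f * MvPowerSeries.coeff v g := by
  have hf : MvPowerSeries.coeff (u.mapDomain Sum.inl) (MvPowerSeries.rename (Sum.inl : σ → σ ⊕ τ) f)
      = MvPowerSeries.coeff u f := by
    have := MvPowerSeries.coeff_embDomain_rename (Function.Embedding.inl : σ ↪ σ ⊕ τ) f u
    rwa [Finsupp.embDomain_eq_mapDomain] at this
  have hg : MvPowerSeries.coeff (v.mapDomain Sum.inr) (MvPowerSeries.rename (Sum.inr : τ → σ ⊕ τ) g)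
      = MvPowerSeries.coeff v g := by
    have := MvPowerSeries.coeff_embDomain_rename (Function.Embedding.inr : τ ↪ σ ⊕ τ) g v
    rwa [Finsupp.embDomain_eq_mapDomain] at this
  rw [MvPowerSeries.coeff_mul, Finset.sum_eq_single (u.mapDomain .inl, v.mapDomain .inr), hf, hg]
  · rintro ⟨a, b⟩ hab hne
    by_cases ha : a ∈ Set.range (Finsupp.mapDomain (M := ℕ) (Sum.inl : σ → σ ⊕ τ))
    · by_cases hb : b ∈ Set.range (Finsupp.mapDomain (M := ℕ) (Sum.inr : τ → σ ⊕ τ))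
      · exfalso
        obtain ⟨u', rfl⟩ := ha
        obtain ⟨v', rfl⟩ := hb
        have h : sumExp u' v' = sumExp u v := Finset.HasAntidiagonal.mem_antidiagonal.1 hab
        have hu : u' = u := by
          ext i
          rw [← sumExp_inl u' v', h, sumExp_inl]
        have hv : v' = v := by
          ext i
          rw [← sumExp_inr u' v', h, sumExp_inr]
        exact hne (by rw [hu, hv])
      · rw [MvPowerSeries.coeff_rename_eq_zero _ g hb, mul_zero]
    · rw [MvPowerSeries.coeff_rename_eq_zero _ f ha, zero_mul]
  · intro h
    refine absurd ?_ h
    rw [Finset.HasAntidiagonal.mem_antidiagonal]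
    rfl

theorem boxExp_sumElim {q : ℕ} (x : (σ → Fin q) × (τ → Fin q)) :
    boxExp ((Equiv.sumArrowEquivProdArrow σ τ (Fin q)).symm x) =
      sumExp (boxExp x.1) (boxExp x.2) := by
  ext (i | i)
  · rw [sumExp_inl]; rfl
  · rw [sumExp_inr]; rfl

open scoped Kronecker in
theorem mulMatrix_product (f : MvPowerSeries σ k) (g : MvPowerSeries τ k) (q : ℕ) :
    (mulMatrix (MvPowerSeries.rename Sum.inl f * MvPowerSeries.rename Sum.inr g) q).submatrix
      (Equiv.sumArrowEquivProdArrow σ τ (Fin q)).symm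
      (Equiv.sumArrowEquivProdArrow σ τ (Fin q)).symm = mulMatrix f q ⊗ₖ mulMatrix g q := by
  classical
  ext x y
  rw [Matrix.submatrix_apply, Matrix.kroneckerMap_apply, mulMatrix_apply, mulMatrix_apply,
    mulMatrix_apply, boxExp_sumElim, boxExp_sumElim, sumExp_sub, coeff_rename_inl_mul_rename_inr]
  by_cases h1 : boxExp y.1 ≤ boxExp x.1 <;> by_cases h2 : boxExp y.2 ≤ boxExp x.2 <;>
    simp [sumExp_le_iff, h1, h2]

theorem mulRank_product (f : MvPowerSeries σ k) (g : MvPowerSeries τ k) (q : ℕ) :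
    mulRank (MvPowerSeries.rename Sum.inl f * MvPowerSeries.rename Sum.inr g) q =
      mulRank f q * mulRank g q := by
  rw [mulRank, ← Matrix.rank_submatrix _ (Equiv.sumArrowEquivProdArrow σ τ (Fin q)).symm
    (Equiv.sumArrowEquivProdArrow σ τ (Fin q)).symm, mulMatrix_product, rank_kronecker]
  rfl

end Product


/-! ### Length and dimension over a local algebra with residue field `k` -/

section Length

variable {k R : Type*} [Field k] [CommRing R] [IsLocalRing R] [Algebra k R]

theorem finrank_eq_one_of_isSimpleModule
    (hR : ∀ r : R, ∃ c : k, r - algebraMap k R c ∈ IsLocalRing.maximalIdeal R)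
    (S : Type*) [AddCommGroup S] [Module R S] [Module k S] [IsScalarTower k R S]
    [IsSimpleModule R S] : Module.finrank k S = 1 := by
  have := IsSimpleModule.nontrivial R S
  obtain ⟨x, hx⟩ := exists_ne (0 : S)
  refine finrank_eq_one x hx fun y => ?_
  obtain ⟨r, rfl⟩ := IsSimpleModule.toSpanSingleton_surjective R hx y
  obtain ⟨c, hc⟩ := hR r
  refine ⟨c, ?_⟩
  obtain ⟨I, hI, ⟨e⟩⟩ := (isSimpleModule_iff_quot_maximal (R := R) (M := S)).1 inferInstance
  rw [IsLocalRing.eq_maximalIdeal hI] at e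
  have h0 : (r - algebraMap k R c) • x = 0 := by
    apply e.injective
    rw [map_smul, map_zero]
    obtain ⟨b, hb⟩ := Ideal.Quotient.mk_surjective (e x)
    rw [← hb, ← Ideal.Quotient.mk_eq_mk, ← Submodule.Quotient.mk_smul,
      Submodule.Quotient.mk_eq_zero]
    exact Ideal.mul_mem_right _ _ hc
  rw [sub_smul, algebraMap_smul, sub_eq_zero] at h0
  exact h0.symm

/-- Both sides are additive along a composition series, and simple factors have dimension one. The
`k`-structure is quantified after `h` so that the induction can pass to submodules. -/
theorem IsFiniteLength.length_eq_finrank_of_residue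
    (hR : ∀ r : R, ∃ c : k, r - algebraMap k R c ∈ IsLocalRing.maximalIdeal R)
    {M : Type*} [AddCommGroup M] [Module R M] (h : IsFiniteLength R M) :
    ∀ [Module k M] [IsScalarTower k R M] [FiniteDimensional k M],
      Module.length R M = Module.finrank k M := by
  induction h with
  | of_subsingleton =>
    intros
    rw [Module.length_eq_zero, Module.finrank_zero_of_subsingleton]
    rfl
  | @of_simple_quotient M _ _ N _ hN ih =>
    intros
    have hfin : FiniteDimensional k N :=
      FiniteDimensional.finiteDimensional_submodule (N.restrictScalars k)
    have hadd : Module.finrank k (M ⧸ N) + Module.finrank k N = Module.finrank k M :=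
      (N.restrictScalars k).finrank_quotient_add_finrank
    rw [Module.length_eq_add_of_exact N.subtype N.mkQ N.injective_subtype N.mkQ_surjective
      (LinearMap.exact_subtype_mkQ N), ih, Module.length_eq_one, ← hadd,
      finrank_eq_one_of_isSimpleModule hR (M ⧸ N), add_comm]
    push_cast
    rfl

/-- Over a local `k`-algebra with residue field `k`, length and `k`-dimension agree. -/
theorem length_eq_finrank_of_residue
    (hR : ∀ r : R, ∃ c : k, r - algebraMap k R c ∈ IsLocalRing.maximalIdeal R)
    {M : Type*} [AddCommGroup M] [Module R M] [Module k M] [IsScalarTower k R M]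
    [FiniteDimensional k M] : Module.length R M = Module.finrank k M := by
  have h1 : IsNoetherian R M := isNoetherian_of_tower k inferInstance
  have h2 : IsArtinian R M := isArtinian_of_tower k inferInstance
  exact IsFiniteLength.length_eq_finrank_of_residue hR
    (isFiniteLength_iff_isNoetherian_isArtinian.2 ⟨h1, h2⟩)

end Length

/-! ### The Hilbert-Kunz function as a colength -/

section HilbertKunz

variable {σ : Type*} [Fintype σ] [DecidableEq σ] {k : Type*} [Field k]

theorem mem_maximalIdeal_iff {a : MvPowerSeries σ k} :
    a ∈ IsLocalRing.maximalIdeal (MvPowerSeries σ k) ↔ MvPowerSeries.constantCoeff a = 0 := by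
  rw [IsLocalRing.mem_maximalIdeal, mem_nonunits_iff, MvPowerSeries.isUnit_iff_constantCoeff,
    isUnit_iff_ne_zero, not_not]

theorem maximalIdeal_eq_varPowIdeal :
    IsLocalRing.maximalIdeal (MvPowerSeries σ k) = varPowIdeal σ k 1 := by
  ext a
  rw [mem_maximalIdeal_iff, mem_varPowIdeal_iff]
  have h : ∀ β : σ → Fin 1, boxExp β = 0 := fun β => by ext i; simp
  constructor
  · intro ha
    ext β
    rw [boxTrunc_apply, h]
    exact ha
  · intro ha
    have := congrFun ha 0
    rwa [boxTrunc_apply, h] at this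

theorem sub_C_mem_maximalIdeal (a : MvPowerSeries σ k) :
    a - algebraMap k _ (MvPowerSeries.constantCoeff a) ∈
      IsLocalRing.maximalIdeal (MvPowerSeries σ k) := by
  rw [mem_maximalIdeal_iff, map_sub, MvPowerSeries.algebraMap_apply]
  simp

variable {p : ℕ} [Fact p.Prime] [CharP k p]

theorem pow_char_mem_varPowIdeal {a : MvPowerSeries σ k}
    (ha : a ∈ IsLocalRing.maximalIdeal (MvPowerSeries σ k)) (n : ℕ) :
    a ^ p ^ n ∈ varPowIdeal σ k (p ^ n) := by
  rw [mem_varPowIdeal_iff]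
  ext β
  rw [boxTrunc_apply, Pi.zero_apply]
  by_cases h : ∃ i, (β i : ℕ) ≠ 0
  · obtain ⟨i, hi⟩ := h
    exact coeff_pow_char_of_not_dvd a n (i := i) fun hd =>
      hi (Nat.eq_zero_of_dvd_of_lt hd (β i).2)
  · push Not at h
    have h0 : boxExp β = 0 := by ext i; exact h i
    rw [mem_maximalIdeal_iff] at ha
    rw [h0, MvPowerSeries.coeff_zero_eq_constantCoeff_apply, map_pow, ha,
      zero_pow (pow_ne_zero _ (Fact.out : p.Prime).ne_zero)]

theorem X_mem_maximalIdeal (i : σ) :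
    (MvPowerSeries.X i : MvPowerSeries σ k) ∈ IsLocalRing.maximalIdeal (MvPowerSeries σ k) := by
  rw [mem_maximalIdeal_iff, MvPowerSeries.constantCoeff_X]

theorem frobeniusPower_hypersurfaceMax (f : MvPowerSeries σ k) (n : ℕ) :
    frobeniusPower (hypersurfaceMax f) (p ^ n) =
      (varPowIdeal σ k (p ^ n)).map (Ideal.Quotient.mk (Ideal.span {f})) := by
  apply le_antisymm
  · rw [frobeniusPower, Ideal.span_le]
    rintro _ ⟨y, hy, rfl⟩
    obtain ⟨a, ha, rfl⟩ :=
      (Ideal.mem_map_iff_of_surjective _ Ideal.Quotient.mk_surjective).1 hy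
    exact Ideal.mem_map_of_mem _ (pow_char_mem_varPowIdeal ha n)
  · rw [varPowIdeal, Ideal.map_span, Ideal.span_le]
    rintro _ ⟨_, ⟨i, rfl⟩, rfl⟩
    refine Ideal.subset_span ⟨Ideal.Quotient.mk _ (MvPowerSeries.X i), ?_, ?_⟩
    · exact Ideal.mem_map_of_mem _ (X_mem_maximalIdeal i)
    · simp

/-- The Hilbert-Kunz function of `f` is `n ↦ dim k⟦x⟧ / (x^{pⁿ}, f)`. -/
theorem HK_eq_colength {f : MvPowerSeries σ k}
    (hf : f ∈ IsLocalRing.maximalIdeal (MvPowerSeries σ k)) (n : ℕ) :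
    HK p f n = colength f (p ^ n) := by
  obtain ⟨hloc, hmax⟩ := isLocalRing_hypersurface hf
  have hres : ∀ r : Hypersurface f, ∃ c : k,
      r - algebraMap k _ c ∈ IsLocalRing.maximalIdeal (Hypersurface f) := fun r => by
    obtain ⟨a, rfl⟩ := Ideal.Quotient.mk_surjective r
    refine ⟨MvPowerSeries.constantCoeff a, ?_⟩
    rw [hmax]
    exact Ideal.mem_map_of_mem (Ideal.Quotient.mk (Ideal.span {f})) (sub_C_mem_maximalIdeal a)
  have e : (Hypersurface f ⧸ frobeniusPower (hypersurfaceMax f) (p ^ n)) ≃ₗ[k]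
      (MvPowerSeries σ k ⧸ (varPowIdeal σ k (p ^ n) ⊔ Ideal.span {f})) := by
    rw [frobeniusPower_hypersurfaceMax, sup_comm]
    exact (DoubleQuot.quotQuotEquivQuotSupₐ k (Ideal.span {f})
      (varPowIdeal σ k (p ^ n))).toLinearEquiv
  have := finiteDimensional_quotient f (p ^ n)
  have := e.symm.finiteDimensional
  rw [HK, hilbertKunz, length_eq_finrank_of_residue hres, e.finrank_eq]
  rfl

end HilbertKunz

/-! ### Krull dimension of power series rings and hypersurfaces -/

section KrullDim

variable {k : Type*} [Field k]

theorem le_ringKrullDim_mvPowerSeries_fin (n : ℕ) :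
    (n : WithBot ℕ∞) ≤ ringKrullDim (MvPowerSeries (Fin n) k) := by
  induction n with
  | zero => exact ringKrullDim_nonneg_of_nontrivial
  | succ n ih =>
    rw [ringKrullDim_eq_of_ringEquiv (MvPowerSeries.finSuccEquiv k n).toRingEquiv]
    refine le_trans ?_ ringKrullDim_succ_le_ringKrullDim_powerseries
    push_cast
    gcongr

variable {σ : Type*} [Fintype σ] [DecidableEq σ]

theorem ringKrullDim_mvPowerSeries :
    ringKrullDim (MvPowerSeries σ k) = Fintype.card σ := by
  apply le_antisymm
  · refine (ringKrullDim_le_spanFinrank_maximalIdeal _).trans ?_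
    rw [maximalIdeal_eq_varPowIdeal, varPowIdeal]
    refine Nat.cast_le.2 ((Submodule.spanFinrank_span_le_ncard_of_finite (Set.finite_range _)).trans ?_)
    rw [← Set.image_univ]
    exact (Set.ncard_image_le Set.finite_univ).trans (by simp [Set.ncard_univ])
  · rw [ringKrullDim_eq_of_ringEquiv
      (MvPowerSeries.renameEquiv k (Fintype.equivFin σ)).toRingEquiv]
    exact le_ringKrullDim_mvPowerSeries_fin _

theorem krullDimNat_hypersurface_add_one {f : MvPowerSeries σ k}
    (hf : f ∈ IsLocalRing.maximalIdeal (MvPowerSeries σ k)) (hf0 : f ≠ 0) :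
    krullDimNat (Hypersurface f) + 1 = Fintype.card σ := by
  have h := ringKrullDim_quotient_span_singleton_succ_eq_ringKrullDim_of_mem_nonZeroDivisors
    (mem_nonZeroDivisors_of_ne_zero hf0) hf
  rw [ringKrullDim_mvPowerSeries] at h
  obtain ⟨_, -⟩ := isLocalRing_hypersurface hf
  obtain ⟨d, hd⟩ : ∃ d : ℕ∞, ringKrullDim (Hypersurface f) = d :=
    ⟨_, (WithBot.coe_unbot _ ringKrullDim_ne_bot).symm⟩
  rw [hd] at h
  have h' : d + 1 = (Fintype.card σ : ℕ∞) := by exact_mod_cast h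
  -- Finiteness ensures that `krullDimNat` returns the true dimension and not a default value.
  have hdt : d ≠ ⊤ := by
    rintro rfl
    exact absurd h' (by simp)
  lift d to ℕ using hdt
  rw [krullDimNat, hd]
  exact_mod_cast h'

end KrullDim


/-! ### Free summands via dual families, and the module `F^n_* R` -/

theorem freeRank_set_iff {R M : Type*} [CommRing R] [AddCommGroup M] [Module R M] (r : ℕ) :
    (∃ (i : (Fin r → R) →ₗ[R] M) (π : M →ₗ[R] (Fin r → R)), π ∘ₗ i = LinearMap.id) ↔
      ∃ (m : Fin r → M) (π : Fin r → M →ₗ[R] R), ∀ i j, π i (m j) = if i = j then 1 else 0 := by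
  constructor
  · rintro ⟨i, π, h⟩
    refine ⟨fun j => i (Pi.single j 1), fun l => LinearMap.proj l ∘ₗ π, fun l j => ?_⟩
    have := congrFun (LinearMap.congr_fun h (Pi.single j 1)) l
    rw [LinearMap.comp_apply] at this
    rw [LinearMap.comp_apply, LinearMap.proj_apply, this, LinearMap.id_apply, Pi.single_apply]
  · rintro ⟨m, π, h⟩
    refine ⟨Fintype.linearCombination R m, LinearMap.pi π, ?_⟩
    refine LinearMap.ext fun c => funext fun l => ?_
    simp [Fintype.linearCombination_apply, h]

section Pushforward

variable (k : Type*) [Field k] (p : ℕ) [Fact p.Prime] [CharP k p] (n : ℕ)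

/-- The identity map `R → F^n_* R`. -/
def toPush (R : Type*) [CommRing R] [Algebra k R] : R ≃+ FrobeniusPushforward k p n R :=
  AddEquiv.refl R

variable {R : Type*} [CommRing R] [Algebra k R]

theorem smul_toPush (r x : R) : r • toPush k p n R x = toPush k p n R (r ^ p ^ n * x) := rfl

/-- Multiplication by an element of `R` on `F^n_* R`. -/
def pushMul (a : R) : FrobeniusPushforward k p n R →ₗ[R] FrobeniusPushforward k p n R where
  toFun x := toPush k p n R (a * (toPush k p n R).symm x)
  map_add' x y := by rw [map_add, mul_add, map_add]
  map_smul' r x := by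
    obtain ⟨x, rfl⟩ := (toPush k p n R).surjective x
    rw [RingHom.id_apply, smul_toPush, smul_toPush, AddEquiv.symm_apply_apply,
      AddEquiv.symm_apply_apply, mul_left_comm]

theorem pushMul_toPush (a x : R) :
    pushMul k p n a (toPush k p n R x) = toPush k p n R (a * x) := rfl

end Pushforward

/-! ### Freeness of `F^n_* k⟦x⟧` and the F-signature function of a hypersurface -/

section PowerSeries

variable {σ : Type*} [Fintype σ] [DecidableEq σ] {k : Type*} [Field k]
  {p : ℕ} [Fact p.Prime] [CharP k p] {n : ℕ}

theorem exists_boxExp_add_smul (q : ℕ) (hq : 0 < q) (δ : σ →₀ ℕ) :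
    ∃ (ρ : σ → Fin q) (γ : σ →₀ ℕ), boxExp ρ + q • γ = δ := by
  refine ⟨fun i => ⟨δ i % q, Nat.mod_lt _ hq⟩,
    Finsupp.equivFunOnFinite.symm fun i => δ i / q, ?_⟩
  ext i
  simp [Nat.mod_add_div]

/-- The `A`-linear map `A^{box} → F^n_* A` sending the unit vectors to the monomials `x^β`. -/
def monomialComb (σ k : Type*) [Fintype σ] [DecidableEq σ] [Field k] (p : ℕ) [Fact p.Prime]
    [CharP k p] (n : ℕ) : ((σ → Fin (p ^ n)) → MvPowerSeries σ k) →ₗ[MvPowerSeries σ k]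
      FrobeniusPushforward k p n (MvPowerSeries σ k) :=
  Fintype.linearCombination (MvPowerSeries σ k) fun β =>
    toPush k p n (MvPowerSeries σ k) (MvPowerSeries.monomial (boxExp β) 1)

/-- In `∑ b_β ^ q x^β` the exponents in the class of `ρ` modulo `q = p ^ n` come from the term `β =
ρ` alone. -/
theorem coeff_monomialComb (b : (σ → Fin (p ^ n)) → MvPowerSeries σ k) (ρ : σ → Fin (p ^ n))
    (γ : σ →₀ ℕ) :
    MvPowerSeries.coeff (boxExp ρ + p ^ n • γ)
      ((toPush k p n (MvPowerSeries σ k)).symm (monomialComb σ k p n b)) =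
      MvPowerSeries.coeff γ (b ρ) ^ p ^ n := by
  classical
  rw [monomialComb, Fintype.linearCombination_apply, map_sum, map_sum, Finset.sum_eq_single ρ]
  · rw [smul_toPush, AddEquiv.symm_apply_apply, MvPowerSeries.coeff_mul_monomial,
      if_pos (le_add_of_nonneg_right zero_le), add_tsub_cancel_left, mul_one,
      coeff_smul_pow_char]
  · intro β _ hβ
    rw [smul_toPush, AddEquiv.symm_apply_apply, MvPowerSeries.coeff_mul_monomial]
    split_ifs with h
    · obtain ⟨i, hi⟩ := Function.ne_iff.1 hβ
      rw [coeff_pow_char_of_not_dvd (b β) n (i := i), zero_mul]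
      intro hd
      have hle := h i
      simp only [Finsupp.coe_tsub, Finsupp.coe_add, Pi.sub_apply, Pi.add_apply, boxExp_apply,
        Finsupp.smul_apply, smul_eq_mul] at hd hle
      have hmod := (Nat.modEq_iff_dvd' hle).2 hd
      have h2 : (β i : ℕ) ≡ ρ i [MOD p ^ n] := by simpa [Nat.ModEq] using hmod
      rw [Nat.ModEq, Nat.mod_eq_of_lt (β i).2, Nat.mod_eq_of_lt (ρ i).2] at h2
      exact hi (Fin.ext h2)
    · rfl
  · simp

variable [PerfectRing k p]

theorem exists_root (n : ℕ) (c : k) : ∃ d : k, d ^ p ^ n = c := by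
  have := ExpChar.prime (R := k) (Fact.out : p.Prime)
  exact (iterateFrobeniusEquiv k p n).surjective c

/-- The coefficients of the image are the `p ^ n`-th powers of those of `b`, each exponent occurring
once. Surjectivity takes `p ^ n`-th roots in the perfect field `k`. -/
theorem monomialComb_bijective : Function.Bijective (monomialComb σ k p n) := by
  have hp : 0 < p ^ n := pow_pos (Fact.out : p.Prime).pos n
  constructor
  · refine (injective_iff_map_eq_zero _).2 fun b hb => ?_
    ext ρ γ
    have := coeff_monomialComb b ρ γ
    rw [hb, map_zero, map_zero] at this
    simpa using (pow_eq_zero_iff hp.ne').1 this.symm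
  · intro x
    choose root hroot using exists_root (k := k) (p := p) n
    let b : (σ → Fin (p ^ n)) → MvPowerSeries σ k := fun ρ γ =>
      root (MvPowerSeries.coeff (boxExp ρ + p ^ n • γ)
        ((toPush k p n (MvPowerSeries σ k)).symm x))
    refine ⟨b, (toPush k p n (MvPowerSeries σ k)).symm.injective ?_⟩
    ext δ
    obtain ⟨ρ, γ, rfl⟩ := exists_boxExp_add_smul (p ^ n) hp δ
    rw [coeff_monomialComb]
    exact hroot _

variable (σ k p n) in
/-- The monomials with all exponents less than `pⁿ` form a basis of `F^n_* k⟦x⟧`. -/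
def pushBasis : Module.Basis (σ → Fin (p ^ n)) (MvPowerSeries σ k)
    (FrobeniusPushforward k p n (MvPowerSeries σ k)) :=
  .ofEquivFun (LinearEquiv.ofBijective (monomialComb σ k p n) monomialComb_bijective).symm

theorem coeff_eq_pushBasis_repr (x : MvPowerSeries σ k) (ρ : σ → Fin (p ^ n)) (γ : σ →₀ ℕ) :
    MvPowerSeries.coeff (boxExp ρ + p ^ n • γ) x =
      MvPowerSeries.coeff γ ((pushBasis σ k p n).coord ρ
        (toPush k p n (MvPowerSeries σ k) x)) ^ p ^ n := by
  set E := LinearEquiv.ofBijective (monomialComb σ k p n) monomialComb_bijective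
  have h := coeff_monomialComb (E.symm (toPush k p n (MvPowerSeries σ k) x)) ρ γ
  have hx : monomialComb σ k p n (E.symm (toPush k p n (MvPowerSeries σ k) x)) =
    toPush k p n (MvPowerSeries σ k) x := E.apply_symm_apply _
  rw [hx, AddEquiv.symm_apply_apply] at h
  rw [h]
  rfl

/-- In `F^n_* A` the ideal `(x^q)` is the submodule `𝔪 F^n_* A`, which every linear form maps into
`𝔪`. -/
theorem map_varPowIdeal_mem
    (μ : FrobeniusPushforward k p n (MvPowerSeries σ k) →ₗ[MvPowerSeries σ k] MvPowerSeries σ k)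
    {x : MvPowerSeries σ k} (hx : x ∈ varPowIdeal σ k (p ^ n)) :
    μ (toPush k p n _ x) ∈ IsLocalRing.maximalIdeal (MvPowerSeries σ k) := by
  rw [varPowIdeal] at hx
  obtain ⟨c, rfl⟩ := (Ideal.mem_span_range_iff_exists_fun).1 hx
  rw [map_sum, map_sum]
  refine sum_mem fun i _ => ?_
  rw [mul_comm, ← smul_toPush, map_smul, smul_eq_mul]
  exact Ideal.mul_mem_right _ _ (X_mem_maximalIdeal i)

/-- A family that is dual modulo the maximal ideal to linear forms on `F^n_* k⟦x⟧` is linearly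
independent modulo `(x^q)`. -/
theorem linearIndependent_of_dual {r : ℕ} (v : Fin r → MvPowerSeries σ k)
    (μ : Fin r →
      FrobeniusPushforward k p n (MvPowerSeries σ k) →ₗ[MvPowerSeries σ k] MvPowerSeries σ k)
    (h : ∀ i j, μ i (toPush k p n _ (v j)) - (if i = j then 1 else 0) ∈
      IsLocalRing.maximalIdeal (MvPowerSeries σ k)) :
    LinearIndependent k fun j => boxTrunc σ k (p ^ n) (v j) := by
  rw [Fintype.linearIndependent_iff]
  intro c hc i
  -- With `d j ^ p ^ n = c j`, multiplication by the scalar `c j` on the ring becomes the action of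
  -- `d j` on `F^n_* A`, so that `μ i` can be applied to the relation.
  choose d hd using fun j => exists_root (p := p) n (c j)
  simp only [← map_smul] at hc
  rw [← map_sum, ← mem_varPowIdeal_iff] at hc
  have h1 := map_varPowIdeal_mem (μ i) hc
  have h2 : toPush k p n (MvPowerSeries σ k) (∑ j, c j • v j) =
      ∑ j, (MvPowerSeries.C (d j) : MvPowerSeries σ k) • toPush k p n _ (v j) := by
    rw [map_sum]
    refine Finset.sum_congr rfl fun j _ => ?_
    rw [smul_toPush, ← map_pow, hd, MvPowerSeries.smul_eq_C_mul]
  rw [h2, map_sum, mem_maximalIdeal_iff, map_sum] at h1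
  have h3 : ∀ j, MvPowerSeries.constantCoeff (μ i (toPush k p n _ (v j))) =
      if i = j then (1 : k) else 0 := fun j => by
    have := h i j
    rw [mem_maximalIdeal_iff, map_sub, sub_eq_zero] at this
    rw [this]
    split_ifs <;> simp
  simp only [map_smul, smul_eq_mul, map_mul, h3, MvPowerSeries.constantCoeff_C, mul_ite, mul_one,
    mul_zero, Finset.sum_ite_eq, Finset.mem_univ, if_true] at h1
  rw [← hd i, h1, zero_pow (pow_ne_zero _ (Fact.out : p.Prime).ne_zero)]

/-- Linear independence over `k` gives a dual family of functionals on the box. Taking roots of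
their coefficients gives forms on `F^n_* A` that are dual modulo `𝔪`, and an invertible matrix over
the local ring `A` makes the duality exact. -/
theorem exists_dual_of_linearIndependent {r : ℕ} (v : Fin r → MvPowerSeries σ k)
    (h : LinearIndependent k fun j => boxTrunc σ k (p ^ n) (v j)) :
    ∃ μ : Fin r →
      FrobeniusPushforward k p n (MvPowerSeries σ k) →ₗ[MvPowerSeries σ k] MvPowerSeries σ k,
      ∀ i j, μ i (toPush k p n _ (v j)) = if i = j then 1 else 0 := by
  have hexp := ExpChar.prime (R := k) (Fact.out : p.Prime)
  obtain ⟨φ, hφ⟩ := (Fintype.linearCombination k fun j => boxTrunc σ k (p ^ n) (v j))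
    |>.exists_leftInverse_of_injective (LinearMap.ker_eq_bot.2
      (linearIndependent_iff_injective_fintypeLinearCombination.1 h))
  have hφ' : ∀ i j, ∑ β, φ (Pi.single β 1) i * boxTrunc σ k (p ^ n) (v j) β =
      if i = j then 1 else 0 := fun i j => by
    have h1 : φ (boxTrunc σ k (p ^ n) (v j)) = Pi.single j 1 := by
      have := LinearMap.congr_fun hφ (Pi.single j 1)
      rwa [LinearMap.comp_apply, Fintype.linearCombination_apply_single, one_smul] at this
    have h2 := congrFun h1 i
    rw [Pi.single_apply] at h2
    rw [← h2]
    conv_rhs => rw [pi_eq_sum_univ' (boxTrunc σ k (p ^ n) (v j)), map_sum, Finset.sum_apply]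
    refine Finset.sum_congr rfl fun β _ => ?_
    rw [map_smul, Pi.smul_apply, smul_eq_mul, mul_comm]
  choose P hP using fun (i : Fin r) (β : σ → Fin (p ^ n)) =>
    exists_root (p := p) n (φ (Pi.single β 1) i)
  let W : Matrix (σ → Fin (p ^ n)) (Fin r) (MvPowerSeries σ k) := Matrix.of fun β j =>
    (pushBasis σ k p n).coord β (toPush k p n _ (v j))
  let PA : Matrix (Fin r) (σ → Fin (p ^ n)) (MvPowerSeries σ k) := Matrix.of fun i β =>
    MvPowerSeries.C (P i β)
  have hW : ∀ β j, MvPowerSeries.constantCoeff (W β j) ^ p ^ n =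
      boxTrunc σ k (p ^ n) (v j) β := fun β j => by
    have := coeff_eq_pushBasis_repr (p := p) (n := n) (v j) β 0
    rw [smul_zero, add_zero] at this
    exact this.symm
  -- The identity is checked after applying the injective Frobenius of `k`, which turns the roots
  -- `P` back into `φ` and the constant terms of `W` into the box coefficients of `v`.
  have h1 : (PA * W).map (MvPowerSeries.constantCoeff (σ := σ) (R := k)) = 1 := by
    ext i j
    apply (iterateFrobeniusEquiv k p n).injective
    simp only [Matrix.map_apply, Matrix.mul_apply, map_sum, map_mul, PA, Matrix.of_apply,
      MvPowerSeries.constantCoeff_C, iterateFrobeniusEquiv_def, hP, hW]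
    rw [hφ', Matrix.one_apply]
    split_ifs
    · rw [one_pow]
    · rw [zero_pow (pow_ne_zero _ (Fact.out : p.Prime).ne_zero)]
  have h2 : IsUnit (PA * W).det := by
    rw [MvPowerSeries.isUnit_iff_constantCoeff, RingHom.map_det, RingHom.mapMatrix_apply, h1,
      Matrix.det_one]
    exact isUnit_one
  have h3 : ((PA * W)⁻¹ * PA) * W = 1 := by
    rw [Matrix.mul_assoc, Matrix.nonsing_inv_mul _ h2]
  refine ⟨fun i => ∑ β, ((PA * W)⁻¹ * PA) i β • (pushBasis σ k p n).coord β, fun i j => ?_⟩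
  have h4 := congrFun (congrFun h3 i) j
  rw [Matrix.one_apply, Matrix.mul_apply] at h4
  rw [← h4, LinearMap.sum_apply]
  rfl

/-- Free summands of `F^n_* (A/f)` in terms of linear forms on `F^n_* A`. -/
theorem freeSummand_hypersurface_iff (f : MvPowerSeries σ k) (r : ℕ) :
    (∃ (i : (Fin r → Hypersurface f) →ₗ[Hypersurface f]
          FrobeniusPushforward k p n (Hypersurface f))
        (π : FrobeniusPushforward k p n (Hypersurface f) →ₗ[Hypersurface f]
          (Fin r → Hypersurface f)), π ∘ₗ i = LinearMap.id) ↔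
      ∃ (u : Fin r → MvPowerSeries σ k) (μ : Fin r →
        FrobeniusPushforward k p n (MvPowerSeries σ k) →ₗ[MvPowerSeries σ k] MvPowerSeries σ k),
        (∀ i b, f ∣ μ i (toPush k p n _ (f * b))) ∧
        ∀ i j, f ∣ μ i (toPush k p n _ (u j)) - if i = j then 1 else 0 := by
  set mk := Ideal.Quotient.mk (Ideal.span {f}) with hmk
  have hdvd : ∀ {a b : MvPowerSeries σ k}, mk a = mk b ↔ f ∣ a - b := fun {a b} => by
    rw [hmk, Ideal.Quotient.eq, Ideal.mem_span_singleton]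
  rw [freeRank_set_iff]
  constructor
  · rintro ⟨m, π, h⟩
    -- The composite `F^n_* A → F^n_* (A/f) → A/f` is semilinear over `A → A/f`. As `F^n_* A` is
    -- free, it lifts to a form with values in `A` by lifting the values on a basis.
    let πA : Fin r → FrobeniusPushforward k p n (MvPowerSeries σ k) →ₛₗ[mk] Hypersurface f :=
      fun i =>
      { toFun := fun x => π i (toPush k p n _ (mk ((toPush k p n _).symm x)))
        map_add' := fun x y => by rw [map_add, map_add, map_add, map_add]
        map_smul' := fun a x => by
          obtain ⟨x, rfl⟩ := (toPush k p n _).surjective x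
          rw [smul_toPush, AddEquiv.symm_apply_apply, AddEquiv.symm_apply_apply, map_mul, map_pow,
            ← smul_toPush, map_smul, smul_eq_mul] }
    choose w hw using fun (i : Fin r) (β : σ → Fin (p ^ n)) =>
      Ideal.Quotient.mk_surjective (I := Ideal.span {f}) (πA i (pushBasis σ k p n β))
    let μ : Fin r →
        FrobeniusPushforward k p n (MvPowerSeries σ k) →ₗ[MvPowerSeries σ k] MvPowerSeries σ k :=
      fun i => (pushBasis σ k p n).constr ℕ (w i)
    have hμ : ∀ i x, mk (μ i (toPush k p n _ x)) = π i (toPush k p n _ (mk x)) := fun i x => by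
      have : (mk.toSemilinearMap.comp (μ i)) = πA i :=
        (pushBasis σ k p n).ext fun β => by
          rw [LinearMap.comp_apply, Module.Basis.constr_basis]
          exact hw i β
      exact LinearMap.congr_fun this (toPush k p n _ x)
    choose u hu using fun j => Ideal.Quotient.mk_surjective (I := Ideal.span {f})
      ((toPush k p n _).symm (m j))
    refine ⟨u, μ, fun i b => ?_, fun i j => ?_⟩
    · rw [← sub_zero (μ i _), ← hdvd, hμ, map_mul, map_zero,
        show mk f = 0 from Ideal.Quotient.eq_zero_iff_mem.2 (Ideal.mem_span_singleton_self f),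
        zero_mul, map_zero, map_zero]
    · rw [← hdvd, hμ, hu, AddEquiv.apply_symm_apply, h]
      split_ifs <;> simp
  · rintro ⟨u, μ, hμ, h⟩
    -- The divisibility condition says that `μ i` modulo `f` depends only on the class of its
    -- argument modulo `f`. Hence it descends to `F^n_* (A/f)`, with any set-theoretic section `s`
    -- serving to define it.
    have key : ∀ i {a b}, mk a = mk b →
        mk (μ i (toPush k p n _ a)) = mk (μ i (toPush k p n _ b)) := fun i {a b} hab => by
      obtain ⟨c, hc⟩ := hdvd.1 hab
      rw [hdvd, ← map_sub, ← map_sub, hc]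
      exact hμ i c
    let s : Hypersurface f → MvPowerSeries σ k := Function.surjInv Ideal.Quotient.mk_surjective
    have hs : ∀ x, mk (s x) = x := Function.surjInv_eq Ideal.Quotient.mk_surjective
    refine ⟨fun j => toPush k p n _ (mk (u j)), fun i =>
      { toFun := fun x => mk (μ i (toPush k p n _ (s ((toPush k p n _).symm x))))
        map_add' := fun x y => ?_
        map_smul' := fun a x => ?_ }, fun i j => ?_⟩
    · rw [← map_add, ← map_add, ← map_add]
      exact key i (by simp only [hs, map_add])
    · obtain ⟨x, rfl⟩ := (toPush k p n _).surjective x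
      obtain ⟨a, rfl⟩ := Ideal.Quotient.mk_surjective a
      have hsmul : ∀ y, mk a * mk (μ i (toPush k p n _ y)) =
          mk (μ i (toPush k p n _ (a ^ p ^ n * y))) := fun y => by
        rw [← smul_toPush, map_smul, smul_eq_mul, map_mul]
      refine Eq.trans ?_ (hsmul _).symm
      refine key i ?_
      rw [hs, smul_toPush, AddEquiv.symm_apply_apply, AddEquiv.symm_apply_apply, map_mul, hs,
        map_pow]
    · have h1 := hdvd.2 (h i j)
      have h2 : mk (if i = j then 1 else 0) = if i = j then 1 else 0 := by split_ifs <;> simp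
      rw [← h2, ← h1]
      exact key i (hs _)

/-! ### The F-signature function as a rank -/

theorem FS_eq_of_forall {f : MvPowerSeries σ k} {N : ℕ}
    (h : ∀ r, (∃ (u : Fin r → MvPowerSeries σ k) (μ : Fin r →
        FrobeniusPushforward k p n (MvPowerSeries σ k) →ₗ[MvPowerSeries σ k] MvPowerSeries σ k),
        (∀ i b, f ∣ μ i (toPush k p n _ (f * b))) ∧
        ∀ i j, f ∣ μ i (toPush k p n _ (u j)) - if i = j then 1 else 0) ↔ r ≤ N) :
    FS p f n = N := by
  have hset : {r : ℕ | ∃ (i : (Fin r → Hypersurface f) →ₗ[Hypersurface f]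
          FrobeniusPushforward k p n (Hypersurface f))
        (π : FrobeniusPushforward k p n (Hypersurface f) →ₗ[Hypersurface f]
          (Fin r → Hypersurface f)), π ∘ₗ i = LinearMap.id} = Set.Iic N := by
    ext r
    rw [Set.mem_ofPred_eq, freeSummand_hypersurface_iff, h, Set.mem_Iic]
  rw [FS, fSignatureFun, freeRank, hset, csSup_Iic]

/-- The F-signature function of the zero power series. -/
theorem FS_zero : FS p (0 : MvPowerSeries σ k) n = (p ^ n) ^ Fintype.card σ := by
  refine FS_eq_of_forall fun r => ⟨?_, fun hr => ?_⟩
  · rintro ⟨u, μ, -, h⟩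
    have h1 := (linearIndependent_of_dual u μ fun i j => by
      rw [zero_dvd_iff.1 (h i j)]; exact zero_mem _).fintype_card_le_finrank
    simpa using h1
  · have hr' : r ≤ Module.finrank k ((σ → Fin (p ^ n)) → k) := by simpa using hr
    obtain ⟨w, hw⟩ := exists_linearIndependent_of_le_finrank hr'
    choose u hu using fun j => boxTrunc_surjective (σ := σ) (k := k) (p ^ n) (w j)
    obtain ⟨μ, hμ⟩ := exists_dual_of_linearIndependent (p := p) (n := n) u
      (by simpa only [hu] using hw)
    exact ⟨u, μ, fun i b => by simp, fun i j => by rw [hμ, sub_self]⟩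

/-- The F-signature function of `f ≠ 0` is the rank of multiplication by `f^{q-1}` modulo
`(x^q)`, where `q = pⁿ`. -/
theorem FS_eq_mulRank {f : MvPowerSeries σ k}
    (hf : f ∈ IsLocalRing.maximalIdeal (MvPowerSeries σ k)) (hf0 : f ≠ 0) :
    FS p f n = mulRank (f ^ (p ^ n - 1)) (p ^ n) := by
  have hq : f ^ (p ^ n - 1) * f = f ^ p ^ n := by
    rw [← pow_succ, Nat.sub_add_cancel (Nat.one_le_pow _ _ (Fact.out : p.Prime).pos)]
  refine FS_eq_of_forall fun r => ⟨?_, fun hr => ?_⟩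
  · rintro ⟨u, μ, hμ, h⟩
    choose ν hν using hμ
    -- Dividing `μ i (f b)` by `f` is again a linear form, since `A` is a domain. From `f · f ^ (q -
    -- 1) = f ^ q`, which acts on `F^n_* A` as the scalar `f`, it follows that `μ i = ν' i ∘ f ^ (q
    -- - 1)`. So the `f ^ (q - 1) * u j` are dual to `ν'` modulo `𝔪`, and their box truncations are
    -- independent vectors in the image of `f ^ (q - 1)`.
    let ν' : Fin r →
        FrobeniusPushforward k p n (MvPowerSeries σ k) →ₗ[MvPowerSeries σ k] MvPowerSeries σ k :=
      fun i =>
      { toFun := fun x => ν i ((toPush k p n _).symm x)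
        map_add' := fun x y => by
          apply mul_left_cancel₀ hf0
          rw [mul_add, ← hν, ← hν, ← hν, map_add, mul_add, map_add, map_add]
        map_smul' := fun a x => by
          obtain ⟨x, rfl⟩ := (toPush k p n _).surjective x
          apply mul_left_cancel₀ hf0
          rw [smul_toPush, AddEquiv.symm_apply_apply, AddEquiv.symm_apply_apply, RingHom.id_apply,
            smul_eq_mul, mul_left_comm f a, ← hν, ← hν, mul_left_comm f, ← smul_toPush, map_smul,
            smul_eq_mul] }
    have hν' : ∀ i x, ν' i (toPush k p n _ (f ^ (p ^ n - 1) * x)) = μ i (toPush k p n _ x) :=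
      fun i x => by
        apply mul_left_cancel₀ hf0
        change f * ν i (f ^ (p ^ n - 1) * x) = _
        rw [← hν, ← mul_assoc, mul_comm f, hq, ← smul_toPush, map_smul, smul_eq_mul]
    have hli := linearIndependent_of_dual (fun j => f ^ (p ^ n - 1) * u j) ν' fun i j => by
      rw [hν']
      exact Ideal.mem_of_dvd _ (h i j) hf
    have hspan : Submodule.span k (Set.range fun j =>
        boxTrunc σ k (p ^ n) (f ^ (p ^ n - 1) * u j)) ≤
        LinearMap.range (mulMatrix (f ^ (p ^ n - 1)) (p ^ n)).mulVecLin := by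
      rw [Submodule.span_le]
      rintro _ ⟨j, rfl⟩
      exact ⟨_, (boxTrunc_mul _ _ _).symm⟩
    have h1 := Submodule.finrank_mono hspan
    rwa [finrank_span_eq_card hli, Fintype.card_fin] at h1
  · obtain ⟨w, hw⟩ := exists_linearIndependent_of_le_finrank hr
    choose t ht using fun j => (w j).2
    choose u hu using fun j => boxTrunc_surjective (σ := σ) (k := k) (p ^ n) (t j)
    have hw' := hw.map' (Submodule.subtype _) (Submodule.ker_subtype _)
    have hw2 : (fun j => boxTrunc σ k (p ^ n) (f ^ (p ^ n - 1) * u j)) =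
        Submodule.subtype _ ∘ w := by
      funext j
      rw [boxTrunc_mul, hu]
      exact ht j
    obtain ⟨μ, hμ⟩ := exists_dual_of_linearIndependent (p := p) (n := n)
      (fun j => f ^ (p ^ n - 1) * u j) (by rw [hw2]; exact hw')
    -- Precomposing with `f ^ (q - 1)` makes the forms descend: `f b` is sent to `μ i (f ^ q b) = f
    -- μ i (b)`.
    refine ⟨u, fun i => μ i ∘ₗ pushMul k p n (f ^ (p ^ n - 1)), fun i b => ?_, fun i j => ?_⟩
    · rw [LinearMap.comp_apply, pushMul_toPush, ← mul_assoc, hq, ← smul_toPush, map_smul]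
      exact dvd_mul_right _ _
    · rw [LinearMap.comp_apply, pushMul_toPush, hμ, sub_self]
      exact dvd_zero _

/-- Since `f ^ (q - 1) * f = f ^ q` lies in `(x^q)`, the ranks of `f ^ (q - 1)` and `f` add up to at
most `q ^ s`. -/
theorem FS_le_colength {f : MvPowerSeries σ k}
    (hf : f ∈ IsLocalRing.maximalIdeal (MvPowerSeries σ k)) (hf0 : f ≠ 0) :
    FS p f n ≤ colength f (p ^ n) := by
  have hp := pow_pos (Fact.out : p.Prime).pos n
  rw [FS_eq_mulRank hf hf0]
  have h0 : mulMatrix (f ^ (p ^ n - 1)) (p ^ n) * mulMatrix f (p ^ n) = 0 := by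
    rw [← mulMatrix_mul, ← pow_succ, Nat.sub_add_cancel hp]
    refine Matrix.ext_of_mulVec_single fun β => ?_
    obtain ⟨a, ha⟩ := boxTrunc_surjective (σ := σ) (k := k) (p ^ n) (Pi.single β 1)
    rw [← ha, ← boxTrunc_mul, Matrix.zero_mulVec, ← mem_varPowIdeal_iff]
    exact Ideal.mul_mem_right _ _ (pow_char_mem_varPowIdeal hf n)
  have h1 := Matrix.rank_add_rank_le_card_of_mul_eq_zero h0
  have h2 := colength_add_mulRank f (p ^ n)
  simp only [Fintype.card_fun, Fintype.card_fin] at h1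
  rw [mulRank] at h2 ⊢
  omega

end PowerSeries


/-! ### Product formulas and values at `n = 0` -/

section Colength

variable {σ τ : Type*} [Fintype σ] [DecidableEq σ] [Fintype τ] [DecidableEq τ]
  {k : Type*} [Field k] {p : ℕ} [Fact p.Prime] [CharP k p]

/-- Substitute rank = dimension minus colength into the multiplicativity of the rank. -/
theorem colength_product (f : MvPowerSeries σ k) (g : MvPowerSeries τ k) (q : ℕ) :
    (colength (MvPowerSeries.rename Sum.inl f * MvPowerSeries.rename Sum.inr g) q : ℚ) =
      (q : ℚ) ^ Fintype.card τ * colength f q + (q : ℚ) ^ Fintype.card σ * colength g q -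
        colength f q * colength g q := by
  have h := colength_add_mulRank (MvPowerSeries.rename Sum.inl f * MvPowerSeries.rename Sum.inr g) q
  have h1 := colength_add_mulRank f q
  have h2 := colength_add_mulRank g q
  rw [mulRank_product, Fintype.card_sum] at h
  have h' : (colength (MvPowerSeries.rename Sum.inl f * MvPowerSeries.rename Sum.inr g) q : ℚ) +
    mulRank f q * mulRank g q = (q : ℚ) ^ (Fintype.card σ + Fintype.card τ) := by exact_mod_cast h
  have h1' : (colength f q : ℚ) + mulRank f q = (q : ℚ) ^ Fintype.card σ := by exact_mod_cast h1
  have h2' : (colength g q : ℚ) + mulRank g q = (q : ℚ) ^ Fintype.card τ := by exact_mod_cast h2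
  rw [pow_add, ← h1', ← h2'] at h'
  rw [← h1', ← h2']
  linear_combination h'

theorem restrict_phi_eq_colength (f : MvPowerSeries σ k) (m : ℕ) :
    restrict (phi p f) ⟨1 / (p : ℚ) ^ m, m, rfl⟩ =
      (colength f (p ^ m) : ℚ) / ((p ^ m : ℕ) : ℚ) ^ Fintype.card σ := by
  rw [restrict_phi, normalizedColength, pow_one]
  rfl

theorem rename_product_mem_maximalIdeal {f : MvPowerSeries σ k} (g : MvPowerSeries τ k)
    (hf : f ∈ IsLocalRing.maximalIdeal (MvPowerSeries σ k)) :
    MvPowerSeries.rename Sum.inl f * MvPowerSeries.rename Sum.inr g ∈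
      IsLocalRing.maximalIdeal (MvPowerSeries (σ ⊕ τ) k) := by
  rw [mem_maximalIdeal_iff] at hf ⊢
  rw [map_mul, MvPowerSeries.constantCoeff_rename, hf, zero_mul]

theorem rename_product_ne_zero {f : MvPowerSeries σ k} {g : MvPowerSeries τ k}
    (hf : f ≠ 0) (hg : g ≠ 0) :
    MvPowerSeries.rename (Sum.inl : σ → σ ⊕ τ) f * MvPowerSeries.rename Sum.inr g ≠ 0 := by
  obtain ⟨u, hu⟩ := MvPowerSeries.ne_zero_iff_exists_coeff_ne_zero f |>.1 hf
  obtain ⟨v, hv⟩ := MvPowerSeries.ne_zero_iff_exists_coeff_ne_zero g |>.1 hg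
  intro h
  have := coeff_rename_inl_mul_rename_inr f g u v
  rw [h, map_zero] at this
  exact mul_ne_zero hu hv this.symm

theorem HK_apply_zero {f : MvPowerSeries σ k}
    (hf : f ∈ IsLocalRing.maximalIdeal (MvPowerSeries σ k)) : HK p f 0 = 1 := by
  have h0 : mulMatrix f 1 = 0 := by
    classical
    ext γ β
    have h : ∀ β : σ → Fin 1, boxExp β = 0 := fun β => by ext i; simp
    rw [mulMatrix_apply, h, h, if_pos le_rfl, tsub_zero]
    exact mem_maximalIdeal_iff.1 hf
  have h1 := colength_add_mulRank f 1
  rw [mulRank, h0, Matrix.rank_zero, one_pow] at h1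
  rw [HK_eq_colength hf, pow_zero]
  exact h1

variable [PerfectRing k p]

theorem FS_product {f : MvPowerSeries σ k} {g : MvPowerSeries τ k}
    (hf : f ∈ IsLocalRing.maximalIdeal (MvPowerSeries σ k)) (hf0 : f ≠ 0)
    (hg : g ∈ IsLocalRing.maximalIdeal (MvPowerSeries τ k)) (hg0 : g ≠ 0) (n : ℕ) :
    FS p (MvPowerSeries.rename Sum.inl f * MvPowerSeries.rename Sum.inr g) n =
      FS p f n * FS p g n := by
  rw [FS_eq_mulRank hf hf0, FS_eq_mulRank hg hg0,
    FS_eq_mulRank (rename_product_mem_maximalIdeal g hf) (rename_product_ne_zero hf0 hg0),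
    mul_pow, ← map_pow, ← map_pow, mulRank_product]

theorem FS_apply_zero {f : MvPowerSeries σ k}
    (hf : f ∈ IsLocalRing.maximalIdeal (MvPowerSeries σ k)) : FS p f 0 = 1 := by
  by_cases hf0 : f = 0
  · rw [hf0, FS_zero, pow_zero, one_pow]
  · have h1 : mulMatrix (1 : MvPowerSeries σ k) 1 = 1 := by
      refine Matrix.ext_of_mulVec_single fun β => ?_
      obtain ⟨a, ha⟩ := boxTrunc_surjective (σ := σ) (k := k) 1 (Pi.single β 1)
      rw [← ha, ← boxTrunc_mul, one_mul, Matrix.one_mulVec]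
    rw [FS_eq_mulRank hf hf0, pow_zero, Nat.sub_self, pow_zero, mulRank, h1, Matrix.rank_one]
    simp

end Colength

/-! ### Hilbert-Kunz multiplicity and F-signature as limits -/

section Limits

variable {σ : Type*} [Fintype σ] [LinearOrder σ] {k : Type*} [Field k]
  {p : ℕ} [Fact p.Prime] [CharP k p]

/-- The sequence is nondecreasing by `colength_mul_le_succ` and bounded by `exists_colength_mul_le`,
since the dimension is the number of variables minus one. -/
theorem tendsto_hkRatio {f : MvPowerSeries σ k}
    (hf : f ∈ IsLocalRing.maximalIdeal (MvPowerSeries σ k)) (hf0 : f ≠ 0) :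
    Tendsto (hkRatio p (hypersurfaceMax f)) atTop
      (𝓝 (hkMultiplicity p (hypersurfaceMax f))) := by
  have hp : (0 : ℝ) < p := by exact_mod_cast (Fact.out : p.Prime).pos
  have hd := krullDimNat_hypersurface_add_one hf hf0
  set d := krullDimNat (Hypersurface f)
  have hr : ∀ n, hkRatio p (hypersurfaceMax f) n = (colength f (p ^ n) : ℝ) / (p : ℝ) ^ (d * n) :=
    fun n => by
      rw [← HK_eq_colength (p := p) hf]
      rfl
  have hmono : Monotone (hkRatio p (hypersurfaceMax f)) := monotone_nat_of_le_succ fun n => by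
    rw [hr, hr, div_le_div_iff₀ (by positivity) (by positivity)]
    have h := colength_mul_le_succ (p := p) f n
    rw [← hd] at h
    have h' : (colength f (p ^ n) : ℝ) * (p : ℝ) ^ (d + 1) ≤ p * colength f (p ^ (n + 1)) := by
      exact_mod_cast h
    have h2 : (colength f (p ^ n) : ℝ) * (p : ℝ) ^ d ≤ colength f (p ^ (n + 1)) := by
      rw [pow_succ] at h'
      nlinarith
    calc (colength f (p ^ n) : ℝ) * (p : ℝ) ^ (d * (n + 1))
        = ((colength f (p ^ n) : ℝ) * (p : ℝ) ^ d) * (p : ℝ) ^ (d * n) := by ring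
      _ ≤ _ := by gcongr
  obtain ⟨C, hC⟩ := exists_colength_mul_le hf0
  have hbdd : BddAbove (Set.range (hkRatio p (hypersurfaceMax f))) := by
    refine ⟨C, ?_⟩
    rintro _ ⟨n, rfl⟩
    rw [hr, div_le_iff₀ (by positivity)]
    have h := hC (p ^ n)
    rw [← hd, pow_succ, ← mul_assoc] at h
    have h2 := Nat.le_of_mul_le_mul_right h (pow_pos (Fact.out : p.Prime).pos n)
    rw [← pow_mul, mul_comm n] at h2
    exact_mod_cast h2
  have := tendsto_atTop_ciSup hmono hbdd
  rwa [hkMultiplicity, this.limUnder_eq]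

variable {τ : Type*} [Fintype τ] [LinearOrder τ]

theorem tendsto_mul_div_pow_zero {u v : ℕ → ℝ} {a b : ℝ} (hu : Tendsto u atTop (𝓝 a))
    (hv : Tendsto v atTop (𝓝 b)) :
    Tendsto (fun n => u n * v n / (p : ℝ) ^ n) atTop (𝓝 0) := by
  have hp : (1 : ℝ) < p := by exact_mod_cast (Fact.out : p.Prime).one_lt
  exact (hu.mul hv).div_atTop (tendsto_pow_atTop_atTop_of_one_lt hp)

theorem krullDimNat_product {f : MvPowerSeries σ k} {g : MvPowerSeries τ k}
    (hf : f ∈ IsLocalRing.maximalIdeal (MvPowerSeries σ k)) (hf0 : f ≠ 0)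
    (hg : g ∈ IsLocalRing.maximalIdeal (MvPowerSeries τ k)) (hg0 : g ≠ 0) :
    krullDimNat
        (Hypersurface (MvPowerSeries.rename Sum.inl f * MvPowerSeries.rename Sum.inr g :
          MvPowerSeries (σ ⊕ τ) k)) =
      krullDimNat (Hypersurface f) + krullDimNat (Hypersurface g) + 1 := by
  have h1 := krullDimNat_hypersurface_add_one hf hf0
  have h2 := krullDimNat_hypersurface_add_one hg hg0
  have h3 := krullDimNat_hypersurface_add_one (rename_product_mem_maximalIdeal g hf)
    (rename_product_ne_zero hf0 hg0)
  rw [Fintype.card_sum] at h3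
  omega

theorem hkRatio_product {f : MvPowerSeries σ k} {g : MvPowerSeries τ k}
    (hf : f ∈ IsLocalRing.maximalIdeal (MvPowerSeries σ k)) (hf0 : f ≠ 0)
    (hg : g ∈ IsLocalRing.maximalIdeal (MvPowerSeries τ k)) (hg0 : g ≠ 0) (n : ℕ) :
    hkRatio p
        (hypersurfaceMax (MvPowerSeries.rename Sum.inl f * MvPowerSeries.rename Sum.inr g)) n =
      hkRatio p (hypersurfaceMax f) n + hkRatio p (hypersurfaceMax g) n -
        hkRatio p (hypersurfaceMax f) n * hkRatio p (hypersurfaceMax g) n / (p : ℝ) ^ n := by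
  have hp : (p : ℝ) ≠ 0 := by exact_mod_cast (Fact.out : p.Prime).ne_zero
  have h1 : (HK p (MvPowerSeries.rename Sum.inl f * MvPowerSeries.rename Sum.inr g) n : ℝ) =
      ((p : ℝ) ^ n) ^ Fintype.card τ * HK p f n + ((p : ℝ) ^ n) ^ Fintype.card σ * HK p g n -
        HK p f n * HK p g n := by
    rw [HK_eq_colength hf, HK_eq_colength hg,
      HK_eq_colength (rename_product_mem_maximalIdeal g hf)]
    have := colength_product f g (p ^ n)
    push_cast at this
    exact_mod_cast this
  have h2 := krullDimNat_product hf hf0 hg hg0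
  rw [← krullDimNat_hypersurface_add_one hf hf0, ← krullDimNat_hypersurface_add_one hg hg0] at h1
  simp only [hkRatio, h2]
  simp only [HK] at h1
  rw [h1]
  field_simp
  ring

theorem tendsto_hkRatio_product {f : MvPowerSeries σ k} {g : MvPowerSeries τ k}
    (hf : f ∈ IsLocalRing.maximalIdeal (MvPowerSeries σ k)) (hf0 : f ≠ 0)
    (hg : g ∈ IsLocalRing.maximalIdeal (MvPowerSeries τ k)) (hg0 : g ≠ 0) :
    Tendsto (hkRatio p
        (hypersurfaceMax (MvPowerSeries.rename Sum.inl f * MvPowerSeries.rename Sum.inr g))) atTop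
      (𝓝 (hkMultiplicity p (hypersurfaceMax f) + hkMultiplicity p (hypersurfaceMax g))) := by
  have h1 := tendsto_hkRatio (p := p) hf hf0
  have h2 := tendsto_hkRatio (p := p) hg hg0
  have h := (h1.add h2).sub (tendsto_mul_div_pow_zero (p := p) h1 h2)
  rw [sub_zero] at h
  exact h.congr fun n => (hkRatio_product hf hf0 hg hg0 n).symm

/-- The numerator `FS_f FS_g` is at most `HK_f HK_g`, while the dimension of the product exceeds the
sum of the two dimensions by one. The ratio is thus bounded by a convergent sequence divided by `p ^
n`. -/
theorem tendsto_fSignatureRatio_product [PerfectRing k p] {f : MvPowerSeries σ k}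
    {g : MvPowerSeries τ k}
    (hf : f ∈ IsLocalRing.maximalIdeal (MvPowerSeries σ k)) (hf0 : f ≠ 0)
    (hg : g ∈ IsLocalRing.maximalIdeal (MvPowerSeries τ k)) (hg0 : g ≠ 0) :
    Tendsto (fSignatureRatio k p
        (Hypersurface (MvPowerSeries.rename Sum.inl f * MvPowerSeries.rename Sum.inr g :
          MvPowerSeries (σ ⊕ τ) k))) atTop
      (𝓝 0) := by
  have hp : (0 : ℝ) < p := by exact_mod_cast (Fact.out : p.Prime).pos
  refine squeeze_zero (fun n => ?_) (fun n => ?_)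
    (tendsto_mul_div_pow_zero (p := p) (tendsto_hkRatio (p := p) hf hf0)
      (tendsto_hkRatio (p := p) hg hg0))
  · rw [fSignatureRatio]
    positivity
  · have h1 : FS p f n ≤ HK p f n := by
      rw [HK_eq_colength hf]
      exact FS_le_colength hf hf0
    have h2 : FS p g n ≤ HK p g n := by
      rw [HK_eq_colength hg]
      exact FS_le_colength hg hg0
    have h3 : fSignatureFun k p
        (Hypersurface (MvPowerSeries.rename Sum.inl f * MvPowerSeries.rename Sum.inr g :
          MvPowerSeries (σ ⊕ τ) k)) n =
        FS p f n * FS p g n := FS_product hf hf0 hg hg0 n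
    rw [fSignatureRatio, h3, krullDimNat_product hf hf0 hg hg0, hkRatio, hkRatio, div_mul_div_comm,
      div_div, ← pow_add, ← pow_add]
    push_cast
    have he : ∀ a b : ℕ, (a + b + 1) * n = a * n + b * n + n := fun a b => by ring
    rw [he]
    gcongr
    · exact h1
    · exact h2

end Limits

end HKProduct

end

/-! ### The main theorem -/

theorem mainTheorem4 {p : ℕ} [Fact p.Prime] {k : Type*} [Field k] [CharP k p] [PerfectField k]
    {s s' : ℕ} (f : MvPowerSeries (Fin s) k) (g : MvPowerSeries (Fin s') k)
    (hf : f ∈ IsLocalRing.maximalIdeal (MvPowerSeries (Fin s) k))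
    (hg : g ∈ IsLocalRing.maximalIdeal (MvPowerSeries (Fin s') k))
    (fg : MvPowerSeries (Fin s ⊕ Fin s') k)
    (hfg : fg = MvPowerSeries.rename Sum.inl f * MvPowerSeries.rename Sum.inr g) :
    -- (i) weak `p`-fractals
    (HKProduct.IsWeakPFractal p (HKProduct.restrict (HKProduct.phi p f)) →
      HKProduct.IsWeakPFractal p (HKProduct.restrict (HKProduct.phi p g)) →
      HKProduct.IsWeakPFractal p (HKProduct.restrict (HKProduct.phi p fg))) ∧
    -- (ii) rationality of the Hilbert-Kunz series and of the F-signature series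
    (HKProduct.IsRationalSeries (HKProduct.genSeries fun n => (HKProduct.HK p f n : ℚ)) →
      HKProduct.IsRationalSeries (HKProduct.genSeries fun n => (HKProduct.HK p g n : ℚ)) →
      HKProduct.IsRationalSeries (HKProduct.genSeries fun n => (HKProduct.HK p fg n : ℚ))) ∧
    (HKProduct.IsRationalSeries (HKProduct.genSeries fun n => (HKProduct.FS p f n : ℚ)) →
      HKProduct.IsRationalSeries (HKProduct.genSeries fun n => (HKProduct.FS p g n : ℚ)) →
      HKProduct.IsRationalSeries (HKProduct.genSeries fun n => (HKProduct.FS p fg n : ℚ))) ∧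
    -- (iii) quasi-polynomiality of the Hilbert-Kunz function and of the F-signature function
    (HKProduct.IsQuasiPolynomial p (fun n => (HKProduct.HK p f n : ℚ)) →
      HKProduct.IsQuasiPolynomial p (fun n => (HKProduct.HK p g n : ℚ)) →
      HKProduct.IsQuasiPolynomial p (fun n => (HKProduct.HK p fg n : ℚ))) ∧
    (HKProduct.IsQuasiPolynomial p (fun n => (HKProduct.FS p f n : ℚ)) →
      HKProduct.IsQuasiPolynomial p (fun n => (HKProduct.FS p g n : ℚ)) →
      HKProduct.IsQuasiPolynomial p (fun n => (HKProduct.FS p fg n : ℚ))) ∧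
    (f ≠ 0 → g ≠ 0 →
      -- (iv) the limits defining the Hilbert-Kunz multiplicities exist, and these add up
      (Tendsto (HKProduct.hkRatio p (HKProduct.hypersurfaceMax f)) atTop
          (𝓝 (HKProduct.hkMultiplicity p (HKProduct.hypersurfaceMax f))) ∧
        Tendsto (HKProduct.hkRatio p (HKProduct.hypersurfaceMax g)) atTop
          (𝓝 (HKProduct.hkMultiplicity p (HKProduct.hypersurfaceMax g))) ∧
        Tendsto (HKProduct.hkRatio p (HKProduct.hypersurfaceMax fg)) atTop
          (𝓝 (HKProduct.hkMultiplicity p (HKProduct.hypersurfaceMax fg))) ∧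
        HKProduct.hkMultiplicity p (HKProduct.hypersurfaceMax fg) =
          HKProduct.hkMultiplicity p (HKProduct.hypersurfaceMax f) +
            HKProduct.hkMultiplicity p (HKProduct.hypersurfaceMax g)) ∧
      -- (v) the F-signature of the product exists as a limit and vanishes
      (Tendsto (HKProduct.fSignatureRatio k p (HKProduct.Hypersurface fg)) atTop
          (𝓝 (HKProduct.fSignature k p (HKProduct.Hypersurface fg))) ∧
        HKProduct.fSignature k p (HKProduct.Hypersurface fg) = 0)) := by
  have : PerfectRing k p := PerfectField.toPerfectRing p
  subst hfg
  set fg := MvPowerSeries.rename Sum.inl f * MvPowerSeries.rename Sum.inr g with hfg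
  have hfgm := HKProduct.rename_product_mem_maximalIdeal g hf
  have hHK : (fun n => (HKProduct.HK p fg n : ℚ)) =
      (fun n => ((p : ℚ) ^ n) ^ s') * (fun n => (HKProduct.HK p f n : ℚ)) +
      (fun n => ((p : ℚ) ^ n) ^ s) * (fun n => (HKProduct.HK p g n : ℚ)) -
      (fun n => (HKProduct.HK p f n : ℚ)) * (fun n => (HKProduct.HK p g n : ℚ)) := by
    funext n
    have h := HKProduct.colength_product f g (p ^ n)
    rw [← HKProduct.HK_eq_colength hf, ← HKProduct.HK_eq_colength hg,
      ← HKProduct.HK_eq_colength hfgm] at h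
    simpa using h
  have hgeo : ∀ t : ℕ, HKProduct.IsShiftFinite fun n => ((p : ℚ) ^ n) ^ t := fun t => by
    have := HKProduct.isShiftFinite_geometric 1 ((p : ℚ) ^ t)
    convert! this using 2 with n
    rw [one_mul, ← pow_mul, ← pow_mul, mul_comm]
  -- The rank description of `FS` requires a nonzero series. If one factor vanishes, so does `fg`,
  -- and `FS` is then an explicit geometric sequence.
  have hFS : (fun n => (HKProduct.FS p fg n : ℚ)) =
        (fun n => (HKProduct.FS p f n : ℚ)) * (fun n => (HKProduct.FS p g n : ℚ)) ∨
      (fun n => (HKProduct.FS p fg n : ℚ)) = fun n => ((p : ℚ) ^ n) ^ (s + s') := by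
    by_cases h0 : f = 0 ∨ g = 0
    · right
      have : fg = 0 := by rcases h0 with h0 | h0 <;> simp [hfg, h0]
      funext n
      rw [this, HKProduct.FS_zero]
      simp
    · left
      rw [not_or] at h0
      funext n
      rw [hfg, HKProduct.FS_product hf h0.1 hg h0.2]
      simp
  refine ⟨fun h1 h2 => ?_, fun h1 h2 => ?_, fun h1 h2 => ?_, fun h1 h2 => ?_, fun h1 h2 => ?_,
    fun hf0 hg0 => ?_⟩
  · rw [HKProduct.isWeakPFractal_iff] at *
    -- On `𝓥` this is `φ_{fg} = φ_f + φ_g - φ_f φ_g`, or `1 - φ_{fg} = (1 - φ_f)(1 - φ_g)`.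
    convert! (h1.add h2).sub (h1.mul h2) using 1
    funext m
    have hp : (p : ℚ) ≠ 0 := by exact_mod_cast (Fact.out : p.Prime).ne_zero
    simp only [Pi.sub_apply, Pi.add_apply, Pi.mul_apply, HKProduct.restrict_phi_eq_colength]
    rw [hfg, HKProduct.colength_product]
    simp only [Fintype.card_sum, Fintype.card_fin]
    push_cast
    field_simp
    ring
  · rw [HKProduct.isRationalSeries_iff] at *
    rw [hHK]
    exact (((hgeo s').mul h1).add ((hgeo s).mul h2)).sub (h1.mul h2)
  · rw [HKProduct.isRationalSeries_iff] at *
    rcases hFS with h | h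
    · rw [h]
      exact h1.mul h2
    · rw [h]
      exact hgeo _
  · refine HKProduct.isQuasiPolynomial_of_mem ?_ fun h => ?_
    · rw [hHK]
      exact sub_mem (add_mem (mul_mem (HKProduct.pow_mem_quasiPolynomials p s') h1.mem)
        (mul_mem (HKProduct.pow_mem_quasiPolynomials p s) h2.mem)) (mul_mem h1.mem h2.mem)
    · have := congrFun h 0
      rw [HKProduct.HK_apply_zero hfgm] at this
      simp at this
  · refine HKProduct.isQuasiPolynomial_of_mem ?_ fun h => ?_
    · rcases hFS with h | h
      · rw [h]
        exact mul_mem h1.mem h2.mem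
      · rw [h]
        exact HKProduct.pow_mem_quasiPolynomials p _
    · have := congrFun h 0
      rw [HKProduct.FS_apply_zero hfgm] at this
      simp at this
  · have h := HKProduct.tendsto_hkRatio_product (p := p) hf hf0 hg hg0
    have hs := HKProduct.tendsto_fSignatureRatio_product (p := p) hf hf0 hg hg0
    refine ⟨⟨HKProduct.tendsto_hkRatio hf hf0, HKProduct.tendsto_hkRatio hg hg0, ?_, h.limUnder_eq⟩,
      ?_, hs.limUnder_eq⟩
    · rw [HKProduct.hkMultiplicity, h.limUnder_eq]
      exact h
    · rw [HKProduct.fSignature, hs.limUnder_eq]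
      exact hs
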